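/- Let $d\ge 1$, let $\lambda$ be Lebesgue measure on $\mathbb{R}^d$, let $-1/(d+1)<s<0$ and put $\beta:=1+1/s<0$. Let $\mathcal{G}$ be the class of all lower semicontinuous convex functions $g:\mathbb{R}^d\to[0,\infty]$ whose effective domain $\{g<\infty\}$ has non-empty interior and which satisfy $g(x)\to\infty$ as $\|x\|\to\infty$. Let $Q$ be a probability measure on $\mathbb{R}^d$ with $\int\|x\|\,dQ<\infty$ whose convex support (the intersection of all closed convex sets of $Q$-measure $1$) has non-empty interior. For $g\in\mathcal{G}$ put $$L(g,Q)=\int g\,dQ+\frac{1}{|\beta|}\int_{\mathbb{R}^d} g(x)^{\beta}\,dx\in[0,\infty],$$ where for $p<0$ we set $0^{p}=\infty$ and $\infty^{p}=0$, and denote by $g(\cdot|Q)$ the Rényi projection of $Q$, i.e. the unique minimizer of $L(\cdot,Q)$ over $\mathcal{G}$. Let $g\in\mathcal{G}$, and call $h:\mathbb{R}^d\to\mathbb{R}$ admissible if there is $t_0>0$ such that $g+th\in\mathcal{G}$ for all $t\in(0,t_0)$. Then $g=g(\cdot|Q)$ if and only if $$\int h\,g^{1/s}\,d\lambda\le\int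 h\,dQ$$ for every admissible $h$ for which both integrals exist in $[-\infty,\infty]$ (with $0\cdot\infty=0$; a function has an integral in $[-\infty,\infty]$ if it is a.e. measurable and its positive or its negative part has finite integral). Moreover, if $g=g(\cdot|Q)$, then both integrals exist in $[-\infty,\infty]$ for every admissible $h$, so that the inequality holds for all of them. -/

import Mathlib

open MeasureTheory Filter Topology
open scoped ENNReal

noncomputable section

namespace Renyi

/-- The convex support of a measure `Q`: the intersection of all closed convex sets `C`
with `Q C = 1`. -/
def csupp {d : ℕ} (Q : Measure (EuclideanSpace ℝ (Fin d))) : Set (EuclideanSpace ℝ (Fin d)) :=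
  ⋂₀ {C | IsClosed C ∧ Convex ℝ C ∧ Q C = 1}

/-- Probability measures on `ℝ^d` whose convex support has non-void interior. -/
def ClassQ₀ (d : ℕ) : Set (Measure (EuclideanSpace ℝ (Fin d))) :=
  {Q | IsProbabilityMeasure Q ∧ (interior (csupp Q)).Nonempty}

/-- Probability measures on `ℝ^d` with finite first moment. -/
def ClassQ₁ (d : ℕ) : Set (Measure (EuclideanSpace ℝ (Fin d))) :=
  {Q | IsProbabilityMeasure Q ∧ ∫⁻ x, ‖x‖ₑ ∂Q < ∞}

/-- The admissible class: non-negative closed (lower semicontinuous) convex functions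
`g : ℝ^d → [0, ∞]` whose effective domain has non-empty interior and which are coercive,
i.e. `g x → ∞` as `‖x‖ → ∞`. Convexity of an extended-real-valued function means convexity
of its epigraph. -/
structure ClassG {d : ℕ} (g : EuclideanSpace ℝ (Fin d) → EReal) : Prop where
  nonneg : ∀ x, 0 ≤ g x
  convex : Convex ℝ {p : EuclideanSpace ℝ (Fin d) × ℝ | g p.1 ≤ (p.2 : EReal)}
  closed : LowerSemicontinuous g
  interior_dom : (interior {x | g x < ⊤}).Nonempty
  coercive : Tendsto g (Bornology.cobounded (EuclideanSpace ℝ (Fin d))) (𝓝 ⊤)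

/-- The power `g(x)^p` with values in `[0, ∞]` of a non-negative extended real; for `p < 0`
the conventions are `0^p = ∞` and `∞^p = 0`. -/
def powFn {d : ℕ} (g : EuclideanSpace ℝ (Fin d) → EReal) (p : ℝ)
    (x : EuclideanSpace ℝ (Fin d)) : ℝ≥0∞ :=
  (g x).toENNReal ^ p

/-- The functional `L_s(g, Q) = ∫ g dQ + |β|⁻¹ ∫ g^β dλ` with `β = 1 + 1/s`, for `g ≥ 0`. -/
def L {d : ℕ} (s : ℝ) (g : EuclideanSpace ℝ (Fin d) → EReal)
    (Q : Measure (EuclideanSpace ℝ (Fin d))) : ℝ≥0∞ :=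
  (∫⁻ x, (g x).toENNReal ∂Q) +
    ENNReal.ofReal (1 / |1 + 1 / s|) * ∫⁻ x, powFn g (1 + 1 / s) x

/-- `g = g_s(· | Q)`: `g` is the unique minimizer of `L_s(·, Q)` over the admissible class. -/
structure IsRenyiProjection {d : ℕ} (s : ℝ) (Q : Measure (EuclideanSpace ℝ (Fin d)))
    (g : EuclideanSpace ℝ (Fin d) → EReal) : Prop where
  mem : ClassG g
  le : ∀ k, ClassG k → L s g Q ≤ L s k Q
  unique : ∀ k, ClassG k → (∀ k', ClassG k' → L s k Q ≤ L s k' Q) → k = g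

/-- The function `g + t h`, where `g` may take the value `∞` and `h` is real-valued. -/
def perturb {d : ℕ} (g : EuclideanSpace ℝ (Fin d) → EReal) (t : ℝ)
    (h : EuclideanSpace ℝ (Fin d) → ℝ) (x : EuclideanSpace ℝ (Fin d)) : EReal :=
  g x + ((t * h x : ℝ) : EReal)

/-- `g + t h` lies in the admissible class for all sufficiently small `t > 0`. -/
def AdmissibleDirection {d : ℕ} (g : EuclideanSpace ℝ (Fin d) → EReal)
    (h : EuclideanSpace ℝ (Fin d) → ℝ) : Prop :=
  ∃ t₀ : ℝ, 0 < t₀ ∧ ∀ t : ℝ, 0 < t → t < t₀ → ClassG (perturb g t h)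

/-- The integral of `f` exists in `[-∞, ∞]`: `f` is a.e. measurable and at least one of
`∫ f⁺` and `∫ f⁻` is finite. -/
def HasExtIntegral {X : Type*} [MeasurableSpace X] (μ : Measure X) (f : X → EReal) : Prop :=
  AEMeasurable f μ ∧ (∫⁻ x, (f x).toENNReal ∂μ ≠ ∞ ∨ ∫⁻ x, (-f x).toENNReal ∂μ ≠ ∞)

/-- The extended integral `∫ f⁺ - ∫ f⁻` in `[-∞, ∞]`, meaningful when `HasExtIntegral μ f`. -/
def extIntegral {X : Type*} [MeasurableSpace X] (μ : Measure X) (f : X → EReal) : EReal :=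
  ((∫⁻ x, (f x).toENNReal ∂μ : ℝ≥0∞) : EReal) - ((∫⁻ x, (-f x).toENNReal ∂μ : ℝ≥0∞) : EReal)

/-- The function `h · g^{1/s}`, with `0 · ∞ = 0`. -/
def weighted {d : ℕ} (s : ℝ) (g : EuclideanSpace ℝ (Fin d) → EReal)
    (h : EuclideanSpace ℝ (Fin d) → ℝ) (x : EuclideanSpace ℝ (Fin d)) : EReal :=
  (h x : EReal) * (powFn g (1 / s) x : EReal)

end Renyi

end

namespace Renyi

/-! Write b = β, so that 1/s = b - 1. The map y ↦ |b|⁻¹ y^b is strictly convex with derivative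
-y^(b-1), so L is convex in g and the stated inequality is its first-order condition at a minimum.
Everything rests on the tangent inequality `young_le` and its strict form `young_lt`. The bound s >
-1/(d+1) means b < -d, which makes 1 + ‖x‖ a competitor with finite L.

Necessity (`step_le`, `necessity`): apply the tangent inequality at g + th and compare with
minimality of g; dividing by t gives the claim with (g + th)^(b-1) in place of g^(b-1). As t → 0,
Fatou handles h⁺ and dominated convergence h⁻. The bound t h⁻ ≤ g makes both negative parts
integrable, so the integrals exist.

Sufficiency: the natural direction k - g is not real-valued where k = ∞. Therefore finite convex κ
are tested first, along `direction`, which may take any constant value -N on {g = ∞}. The choice κ =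
1 + ‖x‖ shows that g is Q-a.e. finite and both terms of L(g, Q) are finite (`Stationary.finite`). A
general k is the increasing limit of its infimal convolutions with n‖·‖, which are finite and convex
(`Stationary.compare`). Adding Young's inequality gives minimality; its equality case gives
uniqueness a.e., which convexity and lower semicontinuity upgrade to uniqueness everywhere
(`ClassG.le_of_ae_eq`). -/

/-! ### Young's inequality for negative powers, and extended-real arithmetic -/

theorem rpow_bernoulli_neg {b r : ℝ} (hb : b < 0) (hr : 0 < r) (hr1 : r ≠ 1) :
    1 + b * (r - 1) < r ^ b := by
  have h1 : Real.log r < r - 1 := Real.log_lt_sub_one_of_pos hr hr1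
  have h2 : b * Real.log r + 1 ≤ Real.exp (b * Real.log r) := Real.add_one_le_exp _
  rw [Real.rpow_def_of_pos hr, mul_comm (Real.log r)]
  nlinarith

/-- By homogeneity this is the Bernoulli inequality for the ratio y / x, scaled by x^b. -/
theorem young_real_lt {b x y : ℝ} (hb : b < 0) (hx : 0 < x) (hy : 0 < y) (hxy : y ≠ x) :
    1 / |b| * x ^ b + x ^ b < x ^ (b - 1) * y + 1 / |b| * y ^ b := by
  have hr : 0 < y / x := div_pos hy hx
  have h := rpow_bernoulli_neg hb hr (by rwa [ne_eq, div_eq_one_iff_eq hx.ne'])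
  have hxb : 0 < x ^ b := Real.rpow_pos_of_pos hx b
  have e1 : x ^ (b - 1) = x ^ b / x := by rw [Real.rpow_sub_one hx.ne']
  have e2 : y ^ b = x ^ b * (y / x) ^ b := by
    rw [← Real.mul_rpow hx.le hr.le, mul_div_cancel₀ _ hx.ne']
  rw [e1, e2, abs_of_neg hb]
  have e3 : x ^ b / x * y = x ^ b * (y / x) := by ring
  rw [e3]
  have hnb : 0 < 1 / -b := one_div_pos.2 (neg_pos.2 hb)
  have hb0 := hb.ne
  have key : 1 / -b + 1 < y / x + 1 / -b * (y / x) ^ b := by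
    have := mul_lt_mul_of_pos_left h hnb
    have e : 1 / -b * (1 + b * (y / x - 1)) = 1 / -b - (y / x - 1) := by field_simp; ring
    linarith
  nlinarith

/-- Young's inequality for the power `b < 0`, with its equality case. -/
theorem young_lt {b : ℝ} (hb : b < 0) {x y : ℝ≥0∞} (hx : x ≠ 0) (hxy : y ≠ x) :
    ENNReal.ofReal (1 / |b|) * x ^ b + x ^ b <
      x ^ (b - 1) * y + ENNReal.ofReal (1 / |b|) * y ^ b := by
  have hc : 0 < 1 / |b| := by have := hb.ne; positivity
  have hc' : ENNReal.ofReal (1 / |b|) ≠ 0 := by simpa using hc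
  have hb1 : b - 1 < 0 := by linarith
  rcases eq_or_ne x ∞ with rfl | hxt
  · rw [ENNReal.top_rpow_of_neg hb, ENNReal.top_rpow_of_neg hb1]
    simp only [mul_zero, add_zero, zero_mul, zero_add]
    have : y ^ b ≠ 0 := by
      rw [ne_eq, ENNReal.rpow_eq_zero_iff]
      rintro (h | h)
      · linarith [h.2]
      · exact hxy h.1
    exact pos_iff_ne_zero.2 (mul_ne_zero hc' this)
  have hfin : ENNReal.ofReal (1 / |b|) * x ^ b + x ^ b < ∞ := by
    have : x ^ b ≠ ∞ := by
      rw [ne_eq, ENNReal.rpow_eq_top_iff]; rintro (h | h)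
      · exact hx h.1
      · exact hxt h.1
    exact lt_top_iff_ne_top.2 (ENNReal.add_ne_top.2
      ⟨ENNReal.mul_ne_top ENNReal.ofReal_ne_top this, this⟩)
  rcases eq_or_ne y 0 with rfl | hy
  · rw [ENNReal.zero_rpow_of_neg hb, ENNReal.mul_top hc', add_top]; exact hfin
  rcases eq_or_ne y ∞ with rfl | hyt
  · have : x ^ (b - 1) ≠ 0 := by
      rw [ne_eq, ENNReal.rpow_eq_zero_iff]; rintro (h | h)
      · exact hx h.1
      · exact hxt h.1
    rw [ENNReal.mul_top this, top_add]; exact hfin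
  have hx' := ENNReal.toReal_pos hx hxt
  have hy' := ENNReal.toReal_pos hy hyt
  have hne : y.toReal ≠ x.toReal := fun h => hxy ((ENNReal.toReal_eq_toReal_iff' hyt hxt).1 h)
  have h := young_real_lt hb hx' hy' hne
  rw [← ENNReal.ofReal_toReal hxt, ← ENNReal.ofReal_toReal hyt,
    ENNReal.ofReal_rpow_of_pos hx', ENNReal.ofReal_rpow_of_pos hx', ENNReal.ofReal_rpow_of_pos hy',
    ← ENNReal.ofReal_mul hc.le, ← ENNReal.ofReal_mul hc.le, ← ENNReal.ofReal_mul (by positivity),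
    ← ENNReal.ofReal_add (by positivity) (by positivity),
    ← ENNReal.ofReal_add (by positivity) (by positivity)]
  exact (ENNReal.ofReal_lt_ofReal_iff (by positivity)).2 h

/-- `x ^ (b - 1) * x = x ^ b` in `[0, ∞]` for `b < 0` and `x ≠ 0`. -/
theorem rpow_sub_one_mul_self {b : ℝ} (hb : b < 0) {x : ℝ≥0∞} (hx : x ≠ 0) :
    x ^ (b - 1) * x = x ^ b := by
  rcases eq_or_ne x ∞ with rfl | hxt
  · rw [ENNReal.top_rpow_of_neg hb, ENNReal.top_rpow_of_neg (by linarith), zero_mul]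
  · conv_rhs => rw [show b = (b - 1) + 1 by ring, ENNReal.rpow_add _ _ hx hxt, ENNReal.rpow_one]

theorem young_le {b : ℝ} (hb : b < 0) {x y : ℝ≥0∞} (hx : x ≠ 0) :
    ENNReal.ofReal (1 / |b|) * x ^ b + x ^ b ≤
      x ^ (b - 1) * y + ENNReal.ofReal (1 / |b|) * y ^ b := by
  rcases eq_or_ne y x with rfl | h
  · rw [rpow_sub_one_mul_self hb hx, add_comm]
  · exact (young_lt hb hx h).le

theorem toENNReal_coe_mul (a : ℝ) (w : ℝ≥0∞) :
    ((a : EReal) * (w : EReal)).toENNReal = ENNReal.ofReal a * w := by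
  rw [EReal.toENNReal_mul' (EReal.coe_ennreal_nonneg w)]; simp

theorem toENNReal_neg_coe_mul (a : ℝ) (w : ℝ≥0∞) :
    (-((a : EReal) * (w : EReal))).toENNReal = ENNReal.ofReal (-a) * w := by
  rw [← EReal.neg_mul, ← EReal.coe_neg, toENNReal_coe_mul]

/-- Comparison of two differences of extended non-negative reals. -/
theorem sub_le_sub_iff_add_le_add {p₁ n₁ p₂ n₂ : ℝ≥0∞} (h₁ : n₁ ≠ ∞) (h₂ : p₂ ≠ ∞) :
    (p₁ : EReal) - (n₁ : EReal) ≤ (p₂ : EReal) - (n₂ : EReal) ↔ p₁ + n₂ ≤ p₂ + n₁ := by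
  lift n₁ to NNReal using h₁
  lift p₂ to NNReal using h₂
  rcases eq_or_ne p₁ ∞ with rfl | h
  · have : ((∞ : ℝ≥0∞) : EReal) - ((n₁ : ℝ≥0∞) : EReal) = ⊤ := by
      exact EReal.top_sub_coe (n₁ : ℝ)
    rw [this]
    have h3 : ((p₂ : ℝ≥0∞) : EReal) - (n₂ : EReal) < ⊤ := by
      refine lt_of_le_of_lt (EReal.sub_le_sub le_rfl (EReal.coe_ennreal_nonneg n₂)) ?_
      rw [sub_zero]; exact EReal.coe_lt_top (p₂ : ℝ)
    simp [h3.ne]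
  rcases eq_or_ne n₂ ∞ with rfl | h'
  · lift p₁ to NNReal using h
    have : ((p₂ : ℝ≥0∞) : EReal) - ((∞ : ℝ≥0∞) : EReal) = ⊥ := by
      simp [sub_eq_add_neg]
    rw [this]
    have h3 : ((p₁ : ℝ≥0∞) : EReal) - ((n₁ : ℝ≥0∞) : EReal) ≠ ⊥ := by
      have : ((p₁ : ℝ≥0∞) : EReal) - ((n₁ : ℝ≥0∞) : EReal) = (((p₁ : ℝ) - (n₁ : ℝ) : ℝ) : EReal) :=
        rfl
      rw [this]; exact EReal.coe_ne_bot _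
    simp [h3]
  lift p₁ to NNReal using h
  lift n₂ to NNReal using h'
  have e1 : ((p₁ : ℝ≥0∞) : EReal) - ((n₁ : ℝ≥0∞) : EReal) = (((p₁ : ℝ) - (n₁ : ℝ) : ℝ) : EReal) :=
    rfl
  have e2 : ((p₂ : ℝ≥0∞) : EReal) - ((n₂ : ℝ≥0∞) : EReal) = (((p₂ : ℝ) - (n₂ : ℝ) : ℝ) : EReal) :=
    rfl
  rw [e1, e2, EReal.coe_le_coe_iff]
  norm_cast
  rw [← NNReal.coe_le_coe]
  push_cast
  constructor <;> intro h <;> linarith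

/-! ### The admissible class and its perturbations -/

section ClassGBasics

variable {d : ℕ} {g k : EuclideanSpace ℝ (Fin d) → EReal}

theorem ClassG.coe_toENNReal (hg : ClassG g) (x : EuclideanSpace ℝ (Fin d)) :
    ((g x).toENNReal : EReal) = g x :=
  EReal.coe_toENNReal (hg.nonneg x)

theorem ClassG.measurable (hg : ClassG g) : Measurable g :=
  hg.closed.measurable

theorem ClassG.measurable_toENNReal (hg : ClassG g) : Measurable fun x => (g x).toENNReal :=
  hg.measurable.ereal_toENNReal

theorem ClassG.coe_toReal (hg : ClassG g) {x : EuclideanSpace ℝ (Fin d)} (hx : g x ≠ ⊤) :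
    ((g x).toReal : EReal) = g x :=
  EReal.coe_toReal hx (ne_bot_of_le_ne_bot EReal.zero_ne_bot (hg.nonneg x))

theorem ClassG.le_combo (hg : ClassG g) {x y : EuclideanSpace ℝ (Fin d)} {u v a b : ℝ}
    (hx : g x ≤ u) (hy : g y ≤ v) (ha : 0 ≤ a) (hb : 0 ≤ b) (hab : a + b = 1) :
    g (a • x + b • y) ≤ ((a * u + b * v : ℝ) : EReal) :=
  hg.convex (x := (x, u)) hx (y := (y, v)) hy ha hb hab

theorem ClassG.toENNReal_combo_le (hg : ClassG g) {x y : EuclideanSpace ℝ (Fin d)} {a b : ℝ}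
    (ha : 0 < a) (hb : 0 < b) (hab : a + b = 1) :
    (g (a • x + b • y)).toENNReal ≤
      ENNReal.ofReal a * (g x).toENNReal + ENNReal.ofReal b * (g y).toENNReal := by
  have ha' : ENNReal.ofReal a ≠ 0 := by simpa using ha
  have hb' : ENNReal.ofReal b ≠ 0 := by simpa using hb
  by_cases hx : g x = ⊤
  · simp [hx, ENNReal.mul_top ha']
  by_cases hy : g y = ⊤
  · simp [hy, ENNReal.mul_top hb']
  have h := hg.le_combo (hg.coe_toReal hx).ge (hg.coe_toReal hy).ge ha.le hb.le hab
  refine (EReal.toENNReal_le_toENNReal h).trans ?_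
  have hx0 : 0 ≤ (g x).toReal := EReal.toReal_nonneg (hg.nonneg x)
  have hy0 : 0 ≤ (g y).toReal := EReal.toReal_nonneg (hg.nonneg y)
  rw [EReal.real_coe_toENNReal, ENNReal.ofReal_add (by positivity) (by positivity),
    ENNReal.ofReal_mul ha.le, ENNReal.ofReal_mul hb.le, EReal.toENNReal_of_ne_top hx,
    EReal.toENNReal_of_ne_top hy]

theorem lowerSemicontinuous_coe_ennreal {X : Type*} [TopologicalSpace X] {F : X → ℝ≥0∞}
    (hF : LowerSemicontinuous F) : LowerSemicontinuous fun x => (F x : EReal) :=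
  continuous_coe_ennreal_ereal.comp_lowerSemicontinuous hF
    fun _ _ h => EReal.coe_ennreal_le_coe_ennreal_iff.2 h

theorem ClassG.lowerSemicontinuous_toENNReal (hg : ClassG g) :
    LowerSemicontinuous fun x => (g x).toENNReal :=
  EReal.continuous_toENNReal.comp_lowerSemicontinuous hg.closed
    fun _ _ h => EReal.toENNReal_le_toENNReal h

theorem ClassG.of_ennreal {F : EuclideanSpace ℝ (Fin d) → ℝ≥0∞}
    (hconv : ∀ x y (a b : ℝ), 0 < a → 0 < b → a + b = 1 →
      F (a • x + b • y) ≤ ENNReal.ofReal a * F x + ENNReal.ofReal b * F y)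
    (hlsc : LowerSemicontinuous F) (hdom : (interior {x | F x < ⊤}).Nonempty)
    (hco : Tendsto F (Bornology.cobounded (EuclideanSpace ℝ (Fin d))) (𝓝 ⊤)) :
    ClassG fun x => (F x : EReal) where
  nonneg x := EReal.coe_ennreal_nonneg _
  convex := by
    rw [convex_iff_forall_pos]
    rintro ⟨x, u⟩ hx ⟨y, v⟩ hy a b ha hb hab
    change (F x : EReal) ≤ (u : EReal) at hx
    change (F y : EReal) ≤ (v : EReal) at hy
    have hle : ∀ {z : EuclideanSpace ℝ (Fin d)} {w : ℝ}, (F z : EReal) ≤ (w : EReal) →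
        F z ≤ ENNReal.ofReal w ∧ 0 ≤ w := by
      intro z w h
      refine ⟨?_, ?_⟩
      · have := EReal.toENNReal_le_toENNReal h
        simpa using this
      · exact EReal.coe_nonneg.1 ((EReal.coe_ennreal_nonneg _).trans h)
    obtain ⟨hx, hu⟩ := hle hx
    obtain ⟨hy, hv⟩ := hle hy
    have h : F (a • x + b • y) ≤ ENNReal.ofReal (a * u + b * v) := by
      refine (hconv x y a b ha hb hab).trans ?_
      rw [ENNReal.ofReal_add (by positivity) (by positivity), ENNReal.ofReal_mul ha.le,
        ENNReal.ofReal_mul hb.le]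
      gcongr
    have h2 := EReal.coe_ennreal_le_coe_ennreal_iff.2 h
    rw [EReal.coe_ennreal_ofReal, max_eq_left (by positivity)] at h2
    exact h2
  closed := lowerSemicontinuous_coe_ennreal hlsc
  interior_dom := by
    have : {x | (F x : EReal) < ⊤} = {x | F x < ⊤} := by
      ext x
      simp [lt_top_iff_ne_top]
    rwa [this]
  coercive := (continuous_coe_ennreal_ereal.tendsto ⊤).comp hco

theorem ClassG.tendsto_toENNReal (hg : ClassG g) :
    Tendsto (fun x => (g x).toENNReal) (Bornology.cobounded (EuclideanSpace ℝ (Fin d)))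
      (𝓝 ⊤) :=
  (EReal.continuous_toENNReal.tendsto ⊤).comp hg.coercive

theorem convexOn_one_add_norm :
    ConvexOn ℝ Set.univ fun x : EuclideanSpace ℝ (Fin d) => 1 + ‖x‖ :=
  (convexOn_const 1 convex_univ).add convexOn_univ_norm

theorem ofReal_combo_le {κ : EuclideanSpace ℝ (Fin d) → ℝ} (hκ : ConvexOn ℝ Set.univ κ)
    (hκ0 : ∀ x, 0 ≤ κ x) (x y : EuclideanSpace ℝ (Fin d)) {a b : ℝ} (ha : 0 < a) (hb : 0 < b)
    (hab : a + b = 1) :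
    ENNReal.ofReal (κ (a • x + b • y)) ≤
      ENNReal.ofReal a * ENNReal.ofReal (κ x) + ENNReal.ofReal b * ENNReal.ofReal (κ y) := by
  rw [← ENNReal.ofReal_mul ha.le, ← ENNReal.ofReal_mul hb.le,
    ← ENNReal.ofReal_add (mul_nonneg ha.le (hκ0 x)) (mul_nonneg hb.le (hκ0 y))]
  exact ENNReal.ofReal_le_ofReal (hκ.2 trivial trivial ha.le hb.le hab)

theorem classG_one_add_norm :
    ClassG fun x : EuclideanSpace ℝ (Fin d) => ((ENNReal.ofReal (1 + ‖x‖) : ℝ≥0∞) : EReal) := by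
  refine ClassG.of_ennreal ?_ ?_ ?_ ?_
  · intro x y a b ha hb hab
    exact ofReal_combo_le convexOn_one_add_norm (fun x => by positivity) x y ha hb hab
  · exact (ENNReal.continuous_ofReal.comp (by fun_prop)).lowerSemicontinuous
  · simp
  · exact ENNReal.tendsto_ofReal_atTop.comp
      (tendsto_atTop_add_const_left _ _ tendsto_norm_cobounded_atTop)

open Classical in
/-- The direction pointing from `g` to the finite function `κ`; its value off the domain of `g`
is the constant `-N`. -/
noncomputable def direction (g : EuclideanSpace ℝ (Fin d) → EReal)
    (κ : EuclideanSpace ℝ (Fin d) → ℝ) (N : ℝ) (x : EuclideanSpace ℝ (Fin d)) : ℝ :=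
  if g x = ⊤ then -N else κ x - (g x).toReal

theorem measurable_direction (hg : ClassG g) {κ : EuclideanSpace ℝ (Fin d) → ℝ}
    (hκ : Measurable κ) (N : ℝ) : Measurable (direction g κ N) :=
  Measurable.ite (hg.measurable (measurableSet_singleton ⊤)) measurable_const
    (hκ.sub hg.measurable.ereal_toReal)

/-- For 0 < t < 1 the perturbation is the convex combination (1 - t) g + t κ. Where g = ∞ it stays
∞, so the value -N does not matter. -/
theorem admissibleDirection_direction (hg : ClassG g) {κ : EuclideanSpace ℝ (Fin d) → ℝ}
    (hκ : ConvexOn ℝ Set.univ κ) (hκc : Continuous κ) (hκ0 : ∀ x, 0 ≤ κ x) (N : ℝ) :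
    AdmissibleDirection g (direction g κ N) := by
  refine ⟨1, one_pos, fun t ht ht1 => ?_⟩
  have ht' : 0 < 1 - t := sub_pos.2 ht1
  have ht0 : ENNReal.ofReal (1 - t) ≠ 0 := by simpa using ht1
  have heq : perturb g t (direction g κ N) = fun x =>
      ((ENNReal.ofReal (1 - t) * (g x).toENNReal + ENNReal.ofReal t * ENNReal.ofReal (κ x) :
        ℝ≥0∞) : EReal) := by
    ext x
    unfold perturb direction
    by_cases hx : g x = ⊤
    · rw [hx, EReal.top_add_coe]
      simp [ENNReal.mul_top ht0]
    · have h0 : 0 ≤ (g x).toReal := EReal.toReal_nonneg (hg.nonneg x)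
      rw [if_neg hx, EReal.toENNReal_of_ne_top hx, ← ENNReal.ofReal_mul ht'.le,
        ← ENNReal.ofReal_mul ht.le, ← ENNReal.ofReal_add (by positivity)
          (mul_nonneg ht.le (hκ0 x)), EReal.coe_ennreal_ofReal,
        max_eq_left (add_nonneg (by positivity) (mul_nonneg ht.le (hκ0 x)))]
      conv_lhs => rw [← hg.coe_toReal hx]
      rw [EReal.toReal_coe, ← EReal.coe_add]
      congr 1
      ring
  rw [heq]
  refine ClassG.of_ennreal ?_ ?_ ?_ ?_
  · intro x y a b ha hb hab
    calc _ ≤ ENNReal.ofReal (1 - t) *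
          (ENNReal.ofReal a * (g x).toENNReal + ENNReal.ofReal b * (g y).toENNReal) +
        ENNReal.ofReal t *
          (ENNReal.ofReal a * ENNReal.ofReal (κ x) + ENNReal.ofReal b * ENNReal.ofReal (κ y)) := by
          gcongr
          · exact hg.toENNReal_combo_le ha hb hab
          · exact ofReal_combo_le hκ hκ0 x y ha hb hab
      _ = _ := by ring
  · refine LowerSemicontinuous.add ?_ ?_
    · exact (ENNReal.continuous_const_mul ENNReal.ofReal_ne_top).comp_lowerSemicontinuous
        hg.lowerSemicontinuous_toENNReal fun _ _ h => mul_le_mul_right h _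
    · exact ((ENNReal.continuous_const_mul ENNReal.ofReal_ne_top).comp
        (ENNReal.continuous_ofReal.comp hκc)).lowerSemicontinuous
  · refine hg.interior_dom.mono (interior_mono fun x hx => ?_)
    have : (g x).toENNReal ≠ ⊤ := EReal.toENNReal_ne_top_iff.2 (ne_of_lt hx)
    exact ENNReal.add_lt_top.2 ⟨ENNReal.mul_lt_top ENNReal.ofReal_lt_top this.lt_top,
      ENNReal.mul_lt_top ENNReal.ofReal_lt_top ENNReal.ofReal_lt_top⟩
  · have h := ((ENNReal.continuous_const_mul (a := ENNReal.ofReal (1 - t))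
      ENNReal.ofReal_ne_top).tendsto ⊤).comp hg.tendsto_toENNReal
    rw [ENNReal.mul_top ht0] at h
    exact tendsto_nhds_top_mono' h fun x => le_self_add

/-- Two functions of the class which agree almost everywhere are comparable everywhere. -/
theorem ClassG.le_of_ae_eq (hg : ClassG g) (hk : ClassG k) (h : g =ᵐ[volume] k)
    (x : EuclideanSpace ℝ (Fin d)) : g x ≤ k x := by
  by_cases hx : k x = ⊤
  · rw [hx]; exact le_top
  -- The domain of k has interior, so some bounded piece of a sublevel set of k has positive
  -- measure.
  obtain ⟨n, hn⟩ : ∃ n : ℕ, volume {y | k y ≤ ((n : ℝ) : EReal) ∧ ‖y‖ ≤ n} ≠ 0 := by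
    by_contra! hcon
    have h0 : volume (⋃ n : ℕ, {y | k y ≤ ((n : ℝ) : EReal) ∧ ‖y‖ ≤ n}) = 0 :=
      measure_iUnion_null hcon
    have hsub : interior {y | k y < ⊤} ⊆
        ⋃ n : ℕ, {y | k y ≤ ((n : ℝ) : EReal) ∧ ‖y‖ ≤ n} := by
      intro y hy
      have hy1 : y ∈ {y | k y < ⊤} := interior_subset hy
      have hy' : k y ≠ ⊤ := ne_of_lt hy1
      obtain ⟨n, hn⟩ := exists_nat_ge (max (k y).toReal ‖y‖)
      refine Set.mem_iUnion.2 ⟨n, ?_, (le_max_right _ _).trans hn⟩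
      rw [← hk.coe_toReal hy']
      exact EReal.coe_le_coe_iff.2 ((le_max_left _ _).trans hn)
    exact (isOpen_interior.measure_pos volume hk.interior_dom).ne'
      (measure_mono_null hsub h0)
  -- Shrinking that piece towards x by the ratio t keeps its measure positive, so it meets {g = k};
  -- there convexity of k bounds g.
  have hpt : ∀ t : ℝ, 0 < t → t < 1 → ∃ y : EuclideanSpace ℝ (Fin d), ‖y‖ ≤ n ∧
      g ((1 - t) • x + t • y) ≤ (((1 - t) * (k x).toReal + t * n : ℝ) : EReal) := by
    intro t ht ht1
    by_contra! hcon
    have himg : volume (AffineMap.homothety x t '' {y | k y ≤ ((n : ℝ) : EReal) ∧ ‖y‖ ≤ n}) ≠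
        0 := by
      rw [Measure.addHaar_image_homothety]
      exact mul_ne_zero (by simpa using fun h => absurd h ht.ne') hn
    refine himg (measure_mono_null ?_ (ae_iff.1 h))
    rintro _ ⟨y, ⟨hy, hyn⟩, rfl⟩
    have e : AffineMap.homothety x t y = (1 - t) • x + t • y := by
      rw [AffineMap.homothety_apply, vsub_eq_sub, vadd_eq_add]
      module
    rw [e]
    intro hgk
    refine (hcon y hyn).not_ge ?_
    rw [hgk]
    exact hk.le_combo (hk.coe_toReal hx).ge hy (by linarith) ht.le (by ring)
  -- As t → 0 these points converge to x and the bounds to k x, which contradicts lower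
  -- semicontinuity of g at x if k x < g x.
  by_contra! hlt
  rw [← hk.coe_toReal hx] at hlt
  obtain ⟨c, hc1, hc2⟩ := EReal.lt_iff_exists_real_btwn.1 hlt
  obtain ⟨δ, hδ, hball⟩ := Metric.eventually_nhds_iff.1 (hg.closed x c hc2)
  have hev1 : ∀ᶠ t : ℝ in 𝓝[>] 0, t * (n + ‖x‖) < δ :=
    nhdsWithin_le_nhds ((Continuous.tendsto' (by fun_prop) 0 0 (by simp) :
      Tendsto (fun t : ℝ => t * (n + ‖x‖)) (𝓝 0) (𝓝 0)).eventually_lt_const hδ)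
  have hev2 : ∀ᶠ t : ℝ in 𝓝[>] 0, (1 - t) * (k x).toReal + t * n < c :=
    nhdsWithin_le_nhds ((Continuous.tendsto' (by fun_prop) 0 (k x).toReal (by simp) :
      Tendsto (fun t : ℝ => (1 - t) * (k x).toReal + t * n) (𝓝 0)
        (𝓝 (k x).toReal)).eventually_lt_const (EReal.coe_lt_coe_iff.1 hc1))
  have hev3 : ∀ᶠ t : ℝ in 𝓝[>] 0, t < 1 := nhdsWithin_le_nhds (eventually_lt_nhds one_pos)
  obtain ⟨t, h1, h2, h3, ht⟩ :=
    (hev1.and (hev2.and (hev3.and (eventually_mem_nhdsWithin (a := (0 : ℝ)))))).exists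
  have ht : 0 < t := ht
  obtain ⟨y, hyn, hy⟩ := hpt t ht h3
  refine (hball (y := (1 - t) • x + t • y) ?_).not_ge
    (hy.trans (EReal.coe_le_coe_iff.2 h2.le))
  rw [dist_eq_norm, show (1 - t) • x + t • y - x = t • (y - x) by module, norm_smul,
    Real.norm_of_nonneg ht.le]
  refine lt_of_le_of_lt ?_ h1
  gcongr
  exact (norm_sub_le _ _).trans (by gcongr)

end ClassGBasics

/-! ### Finite convex approximation from below -/

section InfConvolution

variable {E : Type*} [NormedAddCommGroup E] {K : E → ℝ≥0∞}

/-- The infimal convolution of `K` with `r ‖·‖`. -/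
noncomputable def infConv (K : E → ℝ≥0∞) (r : ℝ) (x : E) : ℝ≥0∞ :=
  ⨅ y, K y + ENNReal.ofReal (r * ‖x - y‖)

theorem infConv_le (K : E → ℝ≥0∞) (r : ℝ) (x : E) : infConv K r x ≤ K x :=
  (iInf_le _ x).trans (by simp)

theorem infConv_mono (K : E → ℝ≥0∞) (x : E) : Monotone fun r => infConv K r x := by
  intro r r' h
  refine iInf_mono fun y => ?_
  gcongr

theorem infConv_le_add (K : E → ℝ≥0∞) {r : ℝ} (hr : 0 ≤ r) (x z : E) :
    infConv K r x ≤ infConv K r z + ENNReal.ofReal (r * ‖x - z‖) := by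
  unfold infConv
  rw [ENNReal.iInf_add]
  refine iInf_mono fun y => ?_
  rw [add_assoc, ← ENNReal.ofReal_add (by positivity) (by positivity)]
  gcongr
  rw [← mul_add]
  gcongr
  rw [add_comm]
  exact norm_sub_le_norm_sub_add_norm_sub x z y

theorem infConv_ne_top {r : ℝ} {y : E} (hy : K y ≠ ∞) (x : E) : infConv K r x ≠ ∞ :=
  ne_top_of_le_ne_top (ENNReal.add_ne_top.2 ⟨hy, ENNReal.ofReal_ne_top⟩) (iInf_le _ y)

theorem continuous_toReal_infConv {r : ℝ} (hr : 0 ≤ r) {y : E} (hy : K y ≠ ∞) :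
    Continuous fun x => (infConv K r x).toReal := by
  refine (LipschitzWith.of_le_add_mul ⟨r, hr⟩ fun x z => ?_).continuous
  have h := infConv_le_add K hr x z
  have h2 := ENNReal.toReal_mono (ENNReal.add_ne_top.2 ⟨infConv_ne_top hy z,
    ENNReal.ofReal_ne_top⟩) h
  rwa [ENNReal.toReal_add (infConv_ne_top hy z) ENNReal.ofReal_ne_top,
    ENNReal.toReal_ofReal (by positivity), ← dist_eq_norm] at h2

/-- The function (x, y) ↦ K y + r‖x - y‖ is jointly convex, and minimising over y preserves
convexity. -/
theorem convexOn_toReal_infConv [NormedSpace ℝ E] (hK : ∀ x y (a b : ℝ), 0 < a → 0 < b → a + b = 1 →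
      K (a • x + b • y) ≤ ENNReal.ofReal a * K x + ENNReal.ofReal b * K y)
    {r : ℝ} (hr : 0 ≤ r) {y : E} (hy : K y ≠ ∞) :
    ConvexOn ℝ Set.univ fun x => (infConv K r x).toReal := by
  rw [convexOn_iff_forall_pos]
  refine ⟨convex_univ, fun x _ z _ a b ha hb hab => ?_⟩
  have key : infConv K r (a • x + b • z) ≤
      ENNReal.ofReal a * infConv K r x + ENNReal.ofReal b * infConv K r z := by
    have ha' : ENNReal.ofReal a ≠ 0 := by simpa using ha
    have hb' : ENNReal.ofReal b ≠ 0 := by simpa using hb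
    unfold infConv
    rw [ENNReal.mul_iInf_of_ne ha' ENNReal.ofReal_ne_top,
      ENNReal.mul_iInf_of_ne hb' ENNReal.ofReal_ne_top, ENNReal.iInf_add]
    refine le_iInf fun u => ?_
    rw [ENNReal.add_iInf]
    refine le_iInf fun v => (iInf_le _ (a • u + b • v)).trans ?_
    have hn : ‖a • x + b • z - (a • u + b • v)‖ ≤ a * ‖x - u‖ + b * ‖z - v‖ := by
      rw [show a • x + b • z - (a • u + b • v) = a • (x - u) + b • (z - v) by module]
      refine (norm_add_le _ _).trans ?_
      rw [norm_smul, norm_smul, Real.norm_of_nonneg ha.le, Real.norm_of_nonneg hb.le]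
    calc K (a • u + b • v) + ENNReal.ofReal (r * ‖a • x + b • z - (a • u + b • v)‖)
        ≤ (ENNReal.ofReal a * K u + ENNReal.ofReal b * K v) +
          (ENNReal.ofReal a * ENNReal.ofReal (r * ‖x - u‖) +
            ENNReal.ofReal b * ENNReal.ofReal (r * ‖z - v‖)) := by
          refine add_le_add (hK u v a b ha hb hab) ?_
          rw [← ENNReal.ofReal_mul ha.le, ← ENNReal.ofReal_mul hb.le,
            ← ENNReal.ofReal_add (by positivity) (by positivity)]
          refine ENNReal.ofReal_le_ofReal ((mul_le_mul_of_nonneg_left hn hr).trans_eq ?_)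
          ring
      _ = _ := by ring
  have hx' := infConv_ne_top (r := r) hy x
  have hz' := infConv_ne_top (r := r) hy z
  have h2 := ENNReal.toReal_mono (ENNReal.add_ne_top.2 ⟨ENNReal.mul_ne_top ENNReal.ofReal_ne_top
    hx', ENNReal.mul_ne_top ENNReal.ofReal_ne_top hz'⟩) key
  rwa [ENNReal.toReal_add (ENNReal.mul_ne_top ENNReal.ofReal_ne_top hx')
    (ENNReal.mul_ne_top ENNReal.ofReal_ne_top hz'), ENNReal.toReal_mul, ENNReal.toReal_mul,
    ENNReal.toReal_ofReal ha.le, ENNReal.toReal_ofReal hb.le] at h2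

/-- Given c' < K x, semicontinuity keeps K above c' on a δ-ball around x, and outside it the penalty
n‖x - y‖ is at least c' once n ≥ c'/δ. -/
theorem iSup_infConv (hK : LowerSemicontinuous K) (x : E) :
    ⨆ n : ℕ, infConv K n x = K x := by
  refine le_antisymm (iSup_le fun n => infConv_le K n x) (le_of_forall_lt fun c hc => ?_)
  obtain ⟨c', hcc, hc'⟩ := exists_between hc
  refine lt_of_lt_of_le hcc ?_
  obtain ⟨δ, hδ, hball⟩ := Metric.eventually_nhds_iff.1 (hK x c' hc')
  obtain ⟨n, hn⟩ := exists_nat_ge (c'.toReal / δ)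
  refine le_iSup_of_le n (le_iInf fun y => ?_)
  by_cases hy : dist y x < δ
  · exact (hball hy).le.trans le_self_add
  · refine le_trans ?_ le_add_self
    rw [← ENNReal.ofReal_toReal hc'.ne_top]
    refine ENNReal.ofReal_le_ofReal ?_
    rw [← dist_eq_norm, dist_comm]
    rw [div_le_iff₀ hδ] at hn
    exact hn.trans (by gcongr; exact not_lt.1 hy)

end InfConvolution

/-! ### Negative powers and the gradient inequality -/

theorem rpow_ne_top_of_neg {b : ℝ} (hb : b < 0) {x : ℝ≥0∞} (hx : x ≠ 0) : x ^ b ≠ ∞ := by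
  rw [ne_eq, ENNReal.rpow_eq_top_iff]
  rintro (h | h)
  · exact hx h.1
  · linarith [h.2]

theorem rpow_le_rpow_of_neg {b : ℝ} (hb : b < 0) {x y : ℝ≥0∞} (h : x ≤ y) : y ^ b ≤ x ^ b := by
  rw [← neg_neg b, ENNReal.rpow_neg, ENNReal.rpow_neg x]
  exact ENNReal.inv_le_inv.2 (ENNReal.rpow_le_rpow h (by linarith))

theorem rpow_sub_one_mul_self_le {b : ℝ} (hb : b < 0) (x : ℝ≥0∞) : x ^ (b - 1) * x ≤ x ^ b := by
  rcases eq_or_ne x 0 with rfl | h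
  · simp
  · exact (rpow_sub_one_mul_self hb h).le

/-- The gradient inequality for `x ↦ |b|⁻¹ x ^ b` with base point `x`, where
`y - x = t (hm - hp)`. -/
theorem gradient_le {b : ℝ} (hb : b < 0) {x y t hp hm : ℝ≥0∞} (hx : x ≠ 0)
    (h : x + t * hm = y + t * hp) :
    ENNReal.ofReal (1 / |b|) * x ^ b + t * (hp * x ^ (b - 1)) ≤
      ENNReal.ofReal (1 / |b|) * y ^ b + t * (hm * x ^ (b - 1)) := by
  have hy := young_le (y := y) hb hx
  refine (ENNReal.add_le_add_iff_right (rpow_ne_top_of_neg hb hx)).1 ?_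
  calc _ = (ENNReal.ofReal (1 / |b|) * x ^ b + x ^ b) + t * (hp * x ^ (b - 1)) := by ring
    _ ≤ (x ^ (b - 1) * y + ENNReal.ofReal (1 / |b|) * y ^ b) + t * (hp * x ^ (b - 1)) := by
      gcongr
    _ = x ^ (b - 1) * (y + t * hp) + ENNReal.ofReal (1 / |b|) * y ^ b := by ring
    _ = x ^ (b - 1) * x + t * (hm * x ^ (b - 1)) + ENNReal.ofReal (1 / |b|) * y ^ b := by
      rw [← h]; ring
    _ = _ := by rw [rpow_sub_one_mul_self hb hx]; ring

/-! ### A minimizer satisfies the variational inequality -/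

section Necessity

variable {d : ℕ} {g : EuclideanSpace ℝ (Fin d) → EReal} {h : EuclideanSpace ℝ (Fin d) → ℝ}
  {t : ℝ}

/-- Splitting h into positive and negative parts avoids subtraction, so the identity also survives
where g = ∞. -/
theorem perturb_balance (hg : ClassG g) (ht : 0 < t) (hp : ClassG (perturb g t h))
    (x : EuclideanSpace ℝ (Fin d)) :
    (perturb g t h x).toENNReal + ENNReal.ofReal t * ENNReal.ofReal (-h x) =
      (g x).toENNReal + ENNReal.ofReal t * ENNReal.ofReal (h x) := by
  have h0 := hp.nonneg x
  unfold perturb at h0 ⊢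
  by_cases hx : g x = ⊤
  · rw [hx, EReal.top_add_coe]; simp
  rw [← hg.coe_toReal hx, ← EReal.coe_add] at h0 ⊢
  have hx0 : 0 ≤ (g x).toReal := EReal.toReal_nonneg (hg.nonneg x)
  have h0 := EReal.coe_nonneg.1 h0
  rw [EReal.real_coe_toENNReal, EReal.real_coe_toENNReal]
  rcases le_total 0 (h x) with hh | hh
  · rw [ENNReal.ofReal_of_nonpos (neg_nonpos.2 hh), mul_zero, add_zero,
      ENNReal.ofReal_add hx0 (by positivity), ENNReal.ofReal_mul ht.le]
  · rw [ENNReal.ofReal_of_nonpos hh, mul_zero, add_zero, ← ENNReal.ofReal_mul ht.le,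
      ← ENNReal.ofReal_add h0 (mul_nonneg ht.le (neg_nonneg.2 hh))]
    congr 1
    ring

theorem ofReal_neg_le (hg : ClassG g) (ht : 0 < t) (hp : ClassG (perturb g t h))
    (x : EuclideanSpace ℝ (Fin d)) :
    ENNReal.ofReal t * ENNReal.ofReal (-h x) ≤ (g x).toENNReal := by
  rcases le_total 0 (h x) with hh | hh
  · simp [ENNReal.ofReal_of_nonpos (neg_nonpos.2 hh)]
  · have := perturb_balance hg ht hp x
    rw [ENNReal.ofReal_of_nonpos hh, mul_zero, add_zero] at this
    rw [← this]
    exact le_add_self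

/-- The function g + th is the midpoint of g and g + 2th, and the latter is non-negative. -/
theorem half_le_perturb (hg : ClassG g) (hp : ClassG (perturb g (2 * t) h))
    (x : EuclideanSpace ℝ (Fin d)) :
    (g x).toENNReal / 2 ≤ (perturb g t h x).toENNReal := by
  have h0 := hp.nonneg x
  unfold perturb at h0 ⊢
  by_cases hx : g x = ⊤
  · rw [hx, EReal.top_add_coe]; simp
  rw [← hg.coe_toReal hx, ← EReal.coe_add] at h0 ⊢
  have h0 := EReal.coe_nonneg.1 h0
  rw [EReal.real_coe_toENNReal, EReal.real_coe_toENNReal,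
    show (2 : ℝ≥0∞) = ENNReal.ofReal 2 by simp, ← ENNReal.ofReal_div_of_pos two_pos]
  exact ENNReal.ofReal_le_ofReal (by linarith)

theorem tendsto_perturb (hg : ClassG g) {u : ℕ → ℝ} (hu : Tendsto u atTop (𝓝 0))
    (x : EuclideanSpace ℝ (Fin d)) :
    Tendsto (fun n => (perturb g (u n) h x).toENNReal) atTop (𝓝 (g x).toENNReal) := by
  unfold perturb
  by_cases hx : g x = ⊤
  · simp only [hx, EReal.top_add_coe]; exact tendsto_const_nhds
  rw [← hg.coe_toReal hx]
  simp only [← EReal.coe_add, EReal.real_coe_toENNReal]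
  refine (ENNReal.continuous_ofReal.tendsto _).comp ?_
  simpa using (hu.mul_const (h x)).const_add (g x).toReal

/-- A direction may be replaced by a measurable one without changing the perturbations of `g`. -/
theorem exists_measurable_direction (hg : ClassG g) (hh : AdmissibleDirection g h) :
    ∃ h' : EuclideanSpace ℝ (Fin d) → ℝ, Measurable h' ∧ ∀ x, g x ≠ ⊤ → h' x = h x := by
  obtain ⟨t₀, ht₀, H⟩ := hh
  have hp := H (t₀ / 2) (by positivity) (by linarith)
  refine ⟨fun x => ((perturb g (t₀ / 2) h x).toReal - (g x).toReal) / (t₀ / 2),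
    (hp.measurable.ereal_toReal.sub hg.measurable.ereal_toReal).div_const _, fun x hx => ?_⟩
  dsimp only
  unfold perturb
  nth_rewrite 1 [← hg.coe_toReal hx]
  rw [← EReal.coe_add, EReal.toReal_coe]
  field_simp
  ring

theorem perturb_congr {h' : EuclideanSpace ℝ (Fin d) → ℝ} (hh : ∀ x, g x ≠ ⊤ → h' x = h x) :
    perturb g t h' = perturb g t h := by
  ext x
  unfold perturb
  by_cases hx : g x = ⊤
  · rw [hx, EReal.top_add_coe, EReal.top_add_coe]
  · rw [hh x hx]

theorem lintegral_ofReal_neg_lt_top (hg : ClassG g) (hh : AdmissibleDirection g h)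
    {Q : Measure (EuclideanSpace ℝ (Fin d))} (hQ : (∫⁻ x, (g x).toENNReal ∂Q) ≠ ∞) :
    (∫⁻ x, ENNReal.ofReal (-h x) ∂Q) ≠ ∞ := by
  obtain ⟨t₀, ht₀, H⟩ := hh
  have ht : 0 < t₀ / 2 := by positivity
  have hp := H (t₀ / 2) ht (by linarith)
  have h1 : (∫⁻ x, ENNReal.ofReal (t₀ / 2) * ENNReal.ofReal (-h x) ∂Q) ≠ ∞ :=
    ne_top_of_le_ne_top hQ (lintegral_mono (ofReal_neg_le hg ht hp))
  rw [lintegral_const_mul' _ _ ENNReal.ofReal_ne_top] at h1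
  exact fun h2 => h1 (by rw [h2, ENNReal.mul_top (by simpa using ht)])

/-- Since t h⁻ ≤ g, the integrand is at most t⁻¹ g^b. -/
theorem lintegral_ofReal_neg_mul_lt_top (hg : ClassG g) (hh : AdmissibleDirection g h)
    {b : ℝ} (hb : b < 0) (hB : (∫⁻ x, (g x).toENNReal ^ b) ≠ ∞) :
    (∫⁻ x, ENNReal.ofReal (-h x) * (g x).toENNReal ^ (b - 1)) ≠ ∞ := by
  obtain ⟨t₀, ht₀, H⟩ := hh
  have ht : 0 < t₀ / 2 := by positivity
  have hp := H (t₀ / 2) ht (by linarith)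
  have h1 : ∫⁻ x, ENNReal.ofReal (t₀ / 2) *
      (ENNReal.ofReal (-h x) * (g x).toENNReal ^ (b - 1)) ≠ ∞ := by
    refine ne_top_of_le_ne_top hB (lintegral_mono fun x => ?_)
    refine le_trans ?_ (rpow_sub_one_mul_self_le hb _)
    dsimp only
    rw [← mul_assoc, mul_comm]
    gcongr
    exact ofReal_neg_le hg ht hp x
  rw [lintegral_const_mul' _ _ ENNReal.ofReal_ne_top] at h1
  exact fun h2 => h1 (by rw [h2, ENNReal.mul_top (by simpa using ht)])

theorem ae_toENNReal_ne_zero (hg : ClassG g) {b : ℝ} (hb : b < 0)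
    (hB : (∫⁻ x, (g x).toENNReal ^ b) ≠ ∞) : ∀ᵐ x, (g x).toENNReal ≠ 0 := by
  filter_upwards [ae_lt_top (hg.measurable_toENNReal.pow_const b) hB] with x hx h0
  rw [h0, ENNReal.zero_rpow_of_neg hb] at hx
  exact lt_irrefl _ hx

/-- The first-order condition along one small step. -/
theorem step_le (hg : ClassG g) (hm : Measurable h) {b : ℝ} (hb : b < 0)
    {Q : Measure (EuclideanSpace ℝ (Fin d))} (ht : 0 < t) (hp : ClassG (perturb g t h))
    (hp2 : ClassG (perturb g (2 * t) h)) (hQ : (∫⁻ x, (g x).toENNReal ∂Q) ≠ ∞)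
    (hB : (∫⁻ x, (g x).toENNReal ^ b) ≠ ∞)
    (hle : (∫⁻ x, (g x).toENNReal ∂Q) + ENNReal.ofReal (1 / |b|) * (∫⁻ x, (g x).toENNReal ^ b) ≤
      (∫⁻ x, (perturb g t h x).toENNReal ∂Q) +
        ENNReal.ofReal (1 / |b|) * (∫⁻ x, (perturb g t h x).toENNReal ^ b)) :
    (∫⁻ x, ENNReal.ofReal (h x) * (perturb g t h x).toENNReal ^ (b - 1)) +
        (∫⁻ x, ENNReal.ofReal (-h x) ∂Q) ≤
      (∫⁻ x, ENNReal.ofReal (h x) ∂Q) +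
        (∫⁻ x, ENNReal.ofReal (-h x) * (perturb g t h x).toENNReal ^ (b - 1)) := by
  have hgm := hg.measurable_toENNReal
  have hpm := hp.measurable_toENNReal
  have hhp : Measurable fun x => ENNReal.ofReal (h x) := hm.ennreal_ofReal
  have hhm : Measurable fun x => ENNReal.ofReal (-h x) := hm.neg.ennreal_ofReal
  have E1 : (∫⁻ x, (perturb g t h x).toENNReal ∂Q) +
      ENNReal.ofReal t * (∫⁻ x, ENNReal.ofReal (-h x) ∂Q) =
      (∫⁻ x, (g x).toENNReal ∂Q) + ENNReal.ofReal t * (∫⁻ x, ENNReal.ofReal (h x) ∂Q) := by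
    rw [← lintegral_const_mul _ hhm, ← lintegral_const_mul _ hhp, ← lintegral_add_left hpm,
      ← lintegral_add_left hgm]
    exact lintegral_congr (perturb_balance hg ht hp)
  have hwp : Measurable fun x => ENNReal.ofReal (h x) * (perturb g t h x).toENNReal ^ (b - 1) :=
    hhp.mul (hpm.pow_const _)
  have hwm : Measurable fun x => ENNReal.ofReal (-h x) * (perturb g t h x).toENNReal ^ (b - 1) :=
    hhm.mul (hpm.pow_const _)
  have E2 : ENNReal.ofReal (1 / |b|) * (∫⁻ x, (perturb g t h x).toENNReal ^ b) +
      ENNReal.ofReal t * (∫⁻ x, ENNReal.ofReal (h x) * (perturb g t h x).toENNReal ^ (b - 1)) ≤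
      ENNReal.ofReal (1 / |b|) * (∫⁻ x, (g x).toENNReal ^ b) +
      ENNReal.ofReal t *
        (∫⁻ x, ENNReal.ofReal (-h x) * (perturb g t h x).toENNReal ^ (b - 1)) := by
    rw [← lintegral_const_mul _ (hpm.pow_const b), ← lintegral_const_mul _ (hgm.pow_const b),
      ← lintegral_const_mul _ hwp,
      ← lintegral_const_mul _ hwm,
      ← lintegral_add_left ((hpm.pow_const b).const_mul _),
      ← lintegral_add_left ((hgm.pow_const b).const_mul _)]
    refine lintegral_mono_ae ?_
    filter_upwards [ae_toENNReal_ne_zero hg hb hB] with x hx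
    refine gradient_le hb (fun h0 => ?_) (perturb_balance hg ht hp x)
    have := half_le_perturb hg hp2 x
    rw [h0, nonpos_iff_eq_zero, ENNReal.div_eq_zero_iff] at this
    rcases this with h | h
    · exact hx h
    · exact ENNReal.ofNat_ne_top h
  have ht0 : ENNReal.ofReal t ≠ 0 := by simpa using ht
  rw [← ENNReal.mul_le_mul_iff_right ht0 ENNReal.ofReal_ne_top, mul_add, mul_add]
  have hfin : (∫⁻ x, (g x).toENNReal ∂Q) + ENNReal.ofReal (1 / |b|) * (∫⁻ x, (g x).toENNReal ^ b) ≠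
      ∞ := ENNReal.add_ne_top.2 ⟨hQ, ENNReal.mul_ne_top ENNReal.ofReal_ne_top hB⟩
  -- The finite value L(g, Q) is added on both sides, since cancellation in [0, ∞] needs finiteness.
  refine (ENNReal.add_le_add_iff_left hfin).1 ?_
  calc _ ≤ ((∫⁻ x, (perturb g t h x).toENNReal ∂Q) +
        ENNReal.ofReal (1 / |b|) * (∫⁻ x, (perturb g t h x).toENNReal ^ b)) +
      (ENNReal.ofReal t *
        (∫⁻ x, ENNReal.ofReal (h x) * (perturb g t h x).toENNReal ^ (b - 1)) +
        ENNReal.ofReal t * (∫⁻ x, ENNReal.ofReal (-h x) ∂Q)) := by gcongr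
    _ = ((∫⁻ x, (perturb g t h x).toENNReal ∂Q) +
          ENNReal.ofReal t * (∫⁻ x, ENNReal.ofReal (-h x) ∂Q)) +
        (ENNReal.ofReal (1 / |b|) * (∫⁻ x, (perturb g t h x).toENNReal ^ b) +
          ENNReal.ofReal t *
            (∫⁻ x, ENNReal.ofReal (h x) * (perturb g t h x).toENNReal ^ (b - 1))) := by ring
    _ ≤ ((∫⁻ x, (g x).toENNReal ∂Q) + ENNReal.ofReal t * ∫⁻ x, ENNReal.ofReal (h x) ∂Q) +
        (ENNReal.ofReal (1 / |b|) * (∫⁻ x, (g x).toENNReal ^ b) + ENNReal.ofReal t *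
          ∫⁻ x, ENNReal.ofReal (-h x) * (perturb g t h x).toENNReal ^ (b - 1)) := by
      rw [E1]; gcongr
    _ = _ := by ring

/-- This is the limit t → 0 of `step_le`. From g + th ≥ g/2 the h⁻ term is dominated by a multiple
of h⁻ g^(b-1); no majorant is available for the h⁺ term, but Fatou gives the direction needed. -/
theorem necessity (hg : ClassG g) (hm : Measurable h) (hh : AdmissibleDirection g h) {b : ℝ}
    (hb : b < 0) {Q : Measure (EuclideanSpace ℝ (Fin d))}
    (hQ : (∫⁻ x, (g x).toENNReal ∂Q) ≠ ∞) (hB : (∫⁻ x, (g x).toENNReal ^ b) ≠ ∞)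
    (hle : ∀ k, ClassG k →
      (∫⁻ x, (g x).toENNReal ∂Q) + ENNReal.ofReal (1 / |b|) * (∫⁻ x, (g x).toENNReal ^ b) ≤
      (∫⁻ x, (k x).toENNReal ∂Q) + ENNReal.ofReal (1 / |b|) * (∫⁻ x, (k x).toENNReal ^ b)) :
    (∫⁻ x, ENNReal.ofReal (h x) * (g x).toENNReal ^ (b - 1)) + (∫⁻ x, ENNReal.ofReal (-h x) ∂Q) ≤
      (∫⁻ x, ENNReal.ofReal (h x) ∂Q) +
        (∫⁻ x, ENNReal.ofReal (-h x) * (g x).toENNReal ^ (b - 1)) := by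
  have hN1 := lintegral_ofReal_neg_mul_lt_top hg hh hb hB
  have hN2 := lintegral_ofReal_neg_lt_top hg hh hQ
  by_cases hP2 : (∫⁻ x, ENNReal.ofReal (h x) ∂Q) = ∞
  · rw [hP2, top_add]; exact le_top
  obtain ⟨t₀, ht₀, H⟩ := hh
  -- The factor 1/4 keeps 2 u n below t₀ as well, as `half_le_perturb` requires.
  set u : ℕ → ℝ := fun n => t₀ / 4 * (1 / ((n : ℝ) + 1)) with hu
  have hu0 : ∀ n, 0 < u n := fun n => by positivity
  have hu1 : ∀ n, 2 * u n < t₀ := fun n => by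
    have : 1 / ((n : ℝ) + 1) ≤ 1 := by
      rw [div_le_one (by positivity)]; linarith [n.cast_nonneg (α := ℝ)]
    have : u n ≤ t₀ / 4 * 1 := mul_le_mul_of_nonneg_left this (by positivity)
    linarith
  have hut : Tendsto u atTop (𝓝 0) := by
    have := (tendsto_one_div_add_atTop_nhds_zero_nat (𝕜 := ℝ)).const_mul (t₀ / 4)
    rwa [mul_zero] at this
  have hp : ∀ n, ClassG (perturb g (u n) h) := fun n =>
    H _ (hu0 n) (by linarith [hu0 n, hu1 n])
  have hp2 : ∀ n, ClassG (perturb g (2 * u n) h) := fun n =>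
    H _ (by linarith [hu0 n]) (hu1 n)
  have hstep := fun n => step_le hg hm hb (hu0 n) (hp n) (hp2 n) hQ hB (hle _ (hp n))
  have hhp : Measurable fun x => ENNReal.ofReal (h x) := hm.ennreal_ofReal
  have hhm : Measurable fun x => ENNReal.ofReal (-h x) := hm.neg.ennreal_ofReal
  have hb1 : b - 1 < 0 := by linarith
  have hw : ∀ x, Tendsto (fun n => (perturb g (u n) h x).toENNReal ^ (b - 1)) atTop
      (𝓝 ((g x).toENNReal ^ (b - 1))) := fun x =>
    (ENNReal.continuous_rpow_const.tendsto _).comp (tendsto_perturb hg hut x)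
  have hM : Tendsto (fun n => (∫⁻ x, ENNReal.ofReal (-h x) *
      (perturb g (u n) h x).toENNReal ^ (b - 1))) atTop
      (𝓝 (∫⁻ x, ENNReal.ofReal (-h x) * (g x).toENNReal ^ (b - 1))) := by
    have h2 : ((1 : ℝ≥0∞) / 2) ^ (b - 1) ≠ ∞ := rpow_ne_top_of_neg hb1 (by simp)
    refine tendsto_lintegral_of_dominated_convergence
      (fun x => (1 / 2) ^ (b - 1) * (ENNReal.ofReal (-h x) * (g x).toENNReal ^ (b - 1)))
      (fun n => hhm.mul ((hp n).measurable_toENNReal.pow_const _)) (fun n => ?_) ?_ ?_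
    · refine ae_of_all _ fun x => ?_
      have h3 := rpow_le_rpow_of_neg hb1 (half_le_perturb hg (hp2 n) x)
      have h4 : ((g x).toENNReal / 2) ^ (b - 1) =
          (1 / 2) ^ (b - 1) * (g x).toENNReal ^ (b - 1) := by
        rw [div_eq_mul_inv, mul_comm, ← one_div]
        by_cases h5 : (g x).toENNReal = ∞
        · rw [h5, ENNReal.mul_top (by simp), ENNReal.top_rpow_of_neg hb1, mul_zero]
        · exact ENNReal.mul_rpow_of_ne_top (by simp) h5 _
      calc _ ≤ ENNReal.ofReal (-h x) * ((g x).toENNReal / 2) ^ (b - 1) := mul_le_mul_right h3 _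
        _ = _ := by rw [h4]; ring
    · rw [lintegral_const_mul' _ _ h2]
      exact ENNReal.mul_ne_top h2 hN1
    · exact ae_of_all _ fun x => ENNReal.Tendsto.const_mul (hw x) (Or.inr ENNReal.ofReal_ne_top)
  have hP : (∫⁻ x, ENNReal.ofReal (h x) * (g x).toENNReal ^ (b - 1)) ≤
      liminf (fun n => (∫⁻ x, ENNReal.ofReal (h x) *
        (perturb g (u n) h x).toENNReal ^ (b - 1))) atTop := by
    refine le_trans (lintegral_mono fun x => ?_) (lintegral_liminf_le fun n =>
      hhp.mul ((hp n).measurable_toENNReal.pow_const _))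
    exact (ENNReal.Tendsto.const_mul (hw x) (Or.inr ENNReal.ofReal_ne_top)).liminf_eq.ge
  have hlim := (hM.const_add ((∫⁻ x, ENNReal.ofReal (h x) ∂Q)))
  have hN2le : (∫⁻ x, ENNReal.ofReal (-h x) ∂Q) ≤ (∫⁻ x, ENNReal.ofReal (h x) ∂Q) +
      (∫⁻ x, ENNReal.ofReal (-h x) * (g x).toENNReal ^ (b - 1)) :=
    ge_of_tendsto' hlim fun n => le_add_self.trans (hstep n)
  -- The finite term ∫ h⁻ dQ is moved to the right, leaving only the Fatou term on the left; `hN2le`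
  -- allows it to be added back.
  have hlim2 := ENNReal.Tendsto.sub hlim (tendsto_const_nhds
    (x := (∫⁻ x, ENNReal.ofReal (-h x) ∂Q))) (Or.inr hN2)
  have h5 : liminf (fun n => (∫⁻ x, ENNReal.ofReal (h x) *
        (perturb g (u n) h x).toENNReal ^ (b - 1))) atTop ≤ (∫⁻ x, ENNReal.ofReal (h x) ∂Q) +
      (∫⁻ x, ENNReal.ofReal (-h x) * (g x).toENNReal ^ (b - 1)) -
        (∫⁻ x, ENNReal.ofReal (-h x) ∂Q) := by
    rw [← hlim2.liminf_eq]
    exact liminf_le_liminf (Eventually.of_forall fun n =>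
      ENNReal.le_sub_of_add_le_right hN2 (hstep n))
  calc _ ≤ _ := add_le_add_left (hP.trans h5) _
    _ = _ := tsub_add_cancel_of_le hN2le

end Necessity

/-! ### The variational inequality implies minimality and uniqueness -/

section Sufficiency

variable {d : ℕ} {g k : EuclideanSpace ℝ (Fin d) → EReal} {κ : EuclideanSpace ℝ (Fin d) → ℝ}
  {Q : Measure (EuclideanSpace ℝ (Fin d))} {b : ℝ}

/-- The variational inequality in terms of positive and negative parts. -/
def Stationary (b : ℝ) (g : EuclideanSpace ℝ (Fin d) → EReal)
    (Q : Measure (EuclideanSpace ℝ (Fin d))) : Prop :=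
  ∀ h : EuclideanSpace ℝ (Fin d) → ℝ, Measurable h → AdmissibleDirection g h →
    (∫⁻ x, ENNReal.ofReal (-h x) * (g x).toENNReal ^ (b - 1)) ≠ ∞ →
    (∫⁻ x, ENNReal.ofReal (h x) ∂Q) ≠ ∞ →
    (∫⁻ x, ENNReal.ofReal (h x) * (g x).toENNReal ^ (b - 1)) +
        (∫⁻ x, ENNReal.ofReal (-h x) ∂Q) ≤
      (∫⁻ x, ENNReal.ofReal (h x) ∂Q) +
        ∫⁻ x, ENNReal.ofReal (-h x) * (g x).toENNReal ^ (b - 1)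

theorem tsub_add_eq_add_tsub_swap (a c : ℝ≥0∞) : a - c + c = a + (c - a) := by
  rw [tsub_add_eq_max, add_comm a, tsub_add_eq_max, max_comm]

theorem ofReal_direction (κ : EuclideanSpace ℝ (Fin d) → ℝ) (hg : ClassG g) {N : ℝ}
    (hN : 0 ≤ N) (x : EuclideanSpace ℝ (Fin d)) :
    ENNReal.ofReal (direction g κ N x) = ENNReal.ofReal (κ x) - (g x).toENNReal := by
  unfold direction
  by_cases hx : g x = ⊤
  · simp [hx, hN]
  · rw [if_neg hx, EReal.toENNReal_of_ne_top hx,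
      ENNReal.ofReal_sub _ (EReal.toReal_nonneg (hg.nonneg x))]

theorem ofReal_neg_direction (hκ0 : ∀ x, 0 ≤ κ x) (N : ℝ) {x : EuclideanSpace ℝ (Fin d)}
    (hx : g x ≠ ⊤) :
    ENNReal.ofReal (-direction g κ N x) = (g x).toENNReal - ENNReal.ofReal (κ x) := by
  unfold direction
  rw [if_neg hx, neg_sub, EReal.toENNReal_of_ne_top hx, ENNReal.ofReal_sub _ (hκ0 x)]

theorem ofReal_neg_direction_mul (hκ0 : ∀ x, 0 ≤ κ x) (hb : b < 0) (N : ℝ)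
    (x : EuclideanSpace ℝ (Fin d)) :
    ENNReal.ofReal (-direction g κ N x) * (g x).toENNReal ^ (b - 1) =
      ((g x).toENNReal - ENNReal.ofReal (κ x)) * (g x).toENNReal ^ (b - 1) := by
  by_cases hx : g x = ⊤
  · rw [hx, EReal.toENNReal_top, ENNReal.top_rpow_of_neg (by linarith), mul_zero, mul_zero]
  · rw [ofReal_neg_direction hκ0 N hx]

/-- On {g = ∞} the weight g^(b-1) vanishes and the direction -N has no positive part, so N survives
only in the integral of the negative part against Q. -/
theorem Stationary.direction_le (hst : Stationary b g Q) (hg : ClassG g) (hb : b < 0)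
    (hκ : ConvexOn ℝ Set.univ κ) (hκc : Continuous κ) (hκ0 : ∀ x, 0 ≤ κ x) {N : ℝ} (hN : 0 ≤ N)
    (h1 : (∫⁻ x, ((g x).toENNReal - ENNReal.ofReal (κ x)) * (g x).toENNReal ^ (b - 1)) ≠ ∞)
    (h2 : (∫⁻ x, ENNReal.ofReal (κ x) ∂Q) ≠ ∞) :
    (∫⁻ x, (ENNReal.ofReal (κ x) - (g x).toENNReal) * (g x).toENNReal ^ (b - 1)) +
        (∫⁻ x, ENNReal.ofReal (-direction g κ N x) ∂Q) ≤
      (∫⁻ x, (ENNReal.ofReal (κ x) - (g x).toENNReal) ∂Q) +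
        ∫⁻ x, ((g x).toENNReal - ENNReal.ofReal (κ x)) * (g x).toENNReal ^ (b - 1) := by
  have h := hst (direction g κ N) (measurable_direction hg hκc.measurable N)
    (admissibleDirection_direction hg hκ hκc hκ0 N)
  simp only [ofReal_neg_direction_mul hκ0 hb, ofReal_direction κ hg hN] at h
  exact h h1 (ne_top_of_le_ne_top h2 (lintegral_mono fun x => tsub_le_self))

theorem lintegral_one_add_norm_rpow_ne_top (hbd : b < -d) :
    (∫⁻ x : EuclideanSpace ℝ (Fin d), ENNReal.ofReal (1 + ‖x‖) ^ b) ≠ ∞ := by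
  have h := finite_integral_one_add_norm (E := EuclideanSpace ℝ (Fin d)) (μ := volume) (r := -b)
    (by rw [finrank_euclideanSpace_fin]; linarith)
  rw [neg_neg] at h
  refine (lt_of_le_of_lt (le_of_eq (lintegral_congr fun x => ?_)) h).ne
  exact ENNReal.ofReal_rpow_of_pos (by positivity)

theorem lintegral_one_add_norm_ne_top [IsProbabilityMeasure Q] (hQ : (∫⁻ x, ‖x‖ₑ ∂Q) < ∞) :
    (∫⁻ x, ENNReal.ofReal (1 + ‖x‖) ∂Q) ≠ ∞ := by
  have : ∀ x : EuclideanSpace ℝ (Fin d), ENNReal.ofReal (1 + ‖x‖) = 1 + ‖x‖ₑ := fun x => by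
    rw [ENNReal.ofReal_add zero_le_one (norm_nonneg x), ENNReal.ofReal_one, ofReal_norm]
  simp only [this]
  rw [lintegral_add_left measurable_const]
  simpa using hQ.ne

/-- The test function 1 + ‖x‖ is integrable against Q and its b-th power against Lebesgue measure,
so the right side of `Stationary.direction_le` is finite, uniformly in N. -/
theorem Stationary.finite [IsProbabilityMeasure Q] (hst : Stationary b g Q) (hg : ClassG g)
    (hbd : b < -d) (hb : b < 0) (hQ : (∫⁻ x, ‖x‖ₑ ∂Q) < ∞) :
    (∀ᵐ x ∂Q, g x ≠ ⊤) ∧ (∫⁻ x, (g x).toENNReal ∂Q) ≠ ∞ ∧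
      (∫⁻ x, (g x).toENNReal ^ b) ≠ ∞ := by
  have hκ0 : ∀ x : EuclideanSpace ℝ (Fin d), 0 ≤ 1 + ‖x‖ := fun x => by positivity
  have hκc : Continuous fun x : EuclideanSpace ℝ (Fin d) => 1 + ‖x‖ := by fun_prop
  have hκm : Measurable fun x : EuclideanSpace ℝ (Fin d) => ENNReal.ofReal (1 + ‖x‖) :=
    hκc.measurable.ennreal_ofReal
  have hκb := lintegral_one_add_norm_rpow_ne_top (d := d) hbd
  have hκQ := lintegral_one_add_norm_ne_top hQ
  have hgm := hg.measurable_toENNReal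
  have h1 : (∫⁻ x, ((g x).toENNReal - ENNReal.ofReal (1 + ‖x‖)) * (g x).toENNReal ^ (b - 1)) ≠
      ∞ := by
    refine ne_top_of_le_ne_top hκb (lintegral_mono fun x => ?_)
    dsimp only
    -- With κ = 1 + ‖x‖: only g ≥ κ contributes, and there (g - κ) g^(b-1) ≤ g^b ≤ κ^b.
    rcases le_total (g x).toENNReal (ENNReal.ofReal (1 + ‖x‖)) with h | h
    · rw [tsub_eq_zero_of_le h, zero_mul]; exact zero_le
    · calc _ ≤ (g x).toENNReal ^ (b - 1) * (g x).toENNReal := by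
            rw [mul_comm]; gcongr; exact tsub_le_self
        _ ≤ (g x).toENNReal ^ b := rpow_sub_one_mul_self_le hb _
        _ ≤ _ := rpow_le_rpow_of_neg hb h
  have hle := fun (N : ℝ) (hN : 0 ≤ N) =>
    hst.direction_le hg hb convexOn_one_add_norm hκc hκ0 hN h1 hκQ
  have hC : (∫⁻ x, (ENNReal.ofReal (1 + ‖x‖) - (g x).toENNReal) ∂Q) +
      (∫⁻ x, ((g x).toENNReal - ENNReal.ofReal (1 + ‖x‖)) * (g x).toENNReal ^ (b - 1)) ≠ ∞ :=
    ENNReal.add_ne_top.2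
      ⟨ne_top_of_le_ne_top hκQ (lintegral_mono fun x => tsub_le_self), h1⟩
  have hnull : Q {x | g x = ⊤} = 0 := by
    by_contra hne
    -- Taking N = n large makes n · Q{g = ∞} exceed the bound, which does not depend on N.
    obtain ⟨n, hn⟩ := ENNReal.exists_nat_mul_gt hne hC
    refine hn.not_ge (le_trans ?_ (le_add_self.trans (hle n n.cast_nonneg)))
    have hmeas : MeasurableSet {x | g x = ⊤} := hg.measurable (measurableSet_singleton ⊤)
    rw [← setLIntegral_const]
    refine (setLIntegral_mono' hmeas fun x hx => ?_).trans (setLIntegral_le_lintegral _ _)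
    have hx : g x = ⊤ := hx
    simp [direction, hx]
  have hae : ∀ᵐ x ∂Q, g x ≠ ⊤ := by rw [ae_iff]; simpa using hnull
  have h0 := ne_top_of_le_ne_top hC (hle 0 le_rfl)
  obtain ⟨hP1, hN2⟩ := ENNReal.add_ne_top.1 h0
  refine ⟨hae, ?_, ?_⟩
  · refine ne_top_of_le_ne_top (ENNReal.add_ne_top.2 ⟨hN2, hκQ⟩) ?_
    rw [← lintegral_add_right _ hκm]
    refine lintegral_mono_ae ?_
    filter_upwards [hae] with x hx
    rw [ofReal_neg_direction hκ0 0 hx]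
    exact le_tsub_add
  · have h2 : ((1 : ℝ≥0∞) / 2) ^ b ≠ ∞ := rpow_ne_top_of_neg hb (by simp)
    have h3 : (∫⁻ x : EuclideanSpace ℝ (Fin d),
        (1 / 2 : ℝ≥0∞) ^ b * ENNReal.ofReal (1 + ‖x‖) ^ b) ≠ ∞ := by
      rw [lintegral_const_mul' _ _ h2]
      exact ENNReal.mul_ne_top h2 hκb
    refine ne_top_of_le_ne_top (ENNReal.add_ne_top.2 ⟨hP1, h3⟩) ?_
    rw [← lintegral_add_right _ ((hκm.pow_const b).const_mul _)]
    refine lintegral_mono fun x => ?_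
    dsimp only
    rw [← ENNReal.mul_rpow_of_ne_top (by simp) ENNReal.ofReal_ne_top]
    -- Where g ≥ κ/2, g^b ≤ (κ/2)^b. Where g ≤ κ/2, κ - g ≥ g, so g^b ≤ (κ - g) g^(b-1).
    rcases le_total (1 / 2 * ENNReal.ofReal (1 + ‖x‖)) (g x).toENNReal with h | h
    · exact (rpow_le_rpow_of_neg hb h).trans le_add_self
    · refine le_trans ?_ le_self_add
      have hpos : ENNReal.ofReal (1 + ‖x‖) ≠ 0 := by
        have : 0 < 1 + ‖x‖ := by positivity
        simpa using this
      rcases eq_or_ne (g x).toENNReal 0 with hz | hz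
      · rw [hz, tsub_zero, ENNReal.zero_rpow_of_neg (by linarith),
          ENNReal.zero_rpow_of_neg (by linarith), ENNReal.mul_top hpos]
      · rw [← rpow_sub_one_mul_self hb hz, mul_comm]
        gcongr
        refine ENNReal.le_sub_of_add_le_left
          (ne_top_of_le_ne_top (ENNReal.mul_ne_top (by simp) ENNReal.ofReal_ne_top) h) ?_
        calc _ ≤ 1 / 2 * ENNReal.ofReal (1 + ‖x‖) + 1 / 2 * ENNReal.ofReal (1 + ‖x‖) := by gcongr
          _ = ENNReal.ofReal (1 + ‖x‖) := by
            rw [← add_mul, ENNReal.add_halves, one_mul]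

/-- The linearised comparison with a finite convex function. -/
theorem Stationary.compare_real (hst : Stationary b g Q) (hg : ClassG g) (hb : b < 0)
    (hae : ∀ᵐ x ∂Q, g x ≠ ⊤) (hgQ : (∫⁻ x, (g x).toENNReal ∂Q) ≠ ∞)
    (hB : (∫⁻ x, (g x).toENNReal ^ b) ≠ ∞)
    (hκ : ConvexOn ℝ Set.univ κ) (hκc : Continuous κ) (hκ0 : ∀ x, 0 ≤ κ x)
    (hκQ : (∫⁻ x, ENNReal.ofReal (κ x) ∂Q) ≠ ∞) :
    (∫⁻ x, ENNReal.ofReal (κ x) * (g x).toENNReal ^ (b - 1)) + (∫⁻ x, (g x).toENNReal ∂Q) ≤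
      (∫⁻ x, ENNReal.ofReal (κ x) ∂Q) + ∫⁻ x, (g x).toENNReal ^ b := by
  have hgm := hg.measurable_toENNReal
  have hκm : Measurable fun x => ENNReal.ofReal (κ x) := hκc.measurable.ennreal_ofReal
  have hwm : Measurable fun x => (g x).toENNReal ^ (b - 1) := hgm.pow_const _
  have hX : (∫⁻ x, (g x).toENNReal * (g x).toENNReal ^ (b - 1)) ≤ ∫⁻ x, (g x).toENNReal ^ b :=
    lintegral_mono fun x => by
      dsimp only
      rw [mul_comm]; exact rpow_sub_one_mul_self_le hb _
  have h1 : (∫⁻ x, ((g x).toENNReal - ENNReal.ofReal (κ x)) * (g x).toENNReal ^ (b - 1)) ≠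
      ∞ := by
    refine ne_top_of_le_ne_top hB (le_trans (lintegral_mono fun x => ?_) hX)
    dsimp only
    gcongr
    exact tsub_le_self
  have h2 : (∫⁻ x, ((g x).toENNReal - ENNReal.ofReal (κ x)) ∂Q) ≠ ∞ :=
    ne_top_of_le_ne_top hgQ (lintegral_mono fun x => tsub_le_self)
  have h := hst.direction_le hg hb hκ hκc hκ0 le_rfl h1 hκQ
  have e0 : (∫⁻ x, ENNReal.ofReal (-direction g κ 0 x) ∂Q) =
      ∫⁻ x, ((g x).toENNReal - ENNReal.ofReal (κ x)) ∂Q := by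
    refine lintegral_congr_ae ?_
    filter_upwards [hae] with x hx using ofReal_neg_direction hκ0 0 hx
  rw [e0] at h
  -- Both sides integrate max(κ, g) g^(b-1); `e2` is the same identity against Q. Together they undo
  -- the truncated differences.
  have e1 : (∫⁻ x, (ENNReal.ofReal (κ x) - (g x).toENNReal) * (g x).toENNReal ^ (b - 1)) +
      (∫⁻ x, (g x).toENNReal * (g x).toENNReal ^ (b - 1)) =
      (∫⁻ x, ENNReal.ofReal (κ x) * (g x).toENNReal ^ (b - 1)) +
      ∫⁻ x, ((g x).toENNReal - ENNReal.ofReal (κ x)) * (g x).toENNReal ^ (b - 1) := by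
    have m1 : Measurable fun x => (g x).toENNReal * (g x).toENNReal ^ (b - 1) := hgm.mul hwm
    have m2 : Measurable fun x => ENNReal.ofReal (κ x) * (g x).toENNReal ^ (b - 1) := hκm.mul hwm
    rw [← lintegral_add_right _ m1, ← lintegral_add_left m2]
    refine lintegral_congr fun x => ?_
    rw [← add_mul, ← add_mul, tsub_add_eq_add_tsub_swap]
  have e2 : (∫⁻ x, (ENNReal.ofReal (κ x) - (g x).toENNReal) ∂Q) +
      (∫⁻ x, (g x).toENNReal ∂Q) = (∫⁻ x, ENNReal.ofReal (κ x) ∂Q) +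
      ∫⁻ x, ((g x).toENNReal - ENNReal.ofReal (κ x)) ∂Q := by
    rw [← lintegral_add_right _ hgm, ← lintegral_add_left hκm]
    exact lintegral_congr fun x => tsub_add_eq_add_tsub_swap _ _
  refine le_trans ?_ (add_le_add_right hX _)
  generalize (∫⁻ x, (ENNReal.ofReal (κ x) - (g x).toENNReal) * (g x).toENNReal ^ (b - 1)) = A
    at *
  generalize (∫⁻ x, ((g x).toENNReal - ENNReal.ofReal (κ x)) * (g x).toENNReal ^ (b - 1)) = N1
    at *
  generalize (∫⁻ x, (ENNReal.ofReal (κ x) - (g x).toENNReal) ∂Q) = P2 at *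
  generalize (∫⁻ x, ((g x).toENNReal - ENNReal.ofReal (κ x)) ∂Q) = N2 at *
  generalize (∫⁻ x, (g x).toENNReal * (g x).toENNReal ^ (b - 1)) = X at *
  generalize (∫⁻ x, ENNReal.ofReal (κ x) * (g x).toENNReal ^ (b - 1)) = Y at *
  generalize (∫⁻ x, (g x).toENNReal ∂Q) = Z at *
  generalize (∫⁻ x, ENNReal.ofReal (κ x) ∂Q) = U at *
  refine (ENNReal.add_le_add_iff_right (ENNReal.add_ne_top.2 ⟨h1, h2⟩)).1 ?_
  calc Y + Z + (N1 + N2) = (Y + N1) + Z + N2 := by ring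
    _ = (A + N2) + X + Z := by rw [← e1]; ring
    _ ≤ (P2 + N1) + X + Z := by gcongr
    _ = (P2 + Z) + X + N1 := by ring
    _ = U + X + (N1 + N2) := by rw [e2]; ring

/-- The linearised comparison with an arbitrary member of the class. -/
theorem Stationary.compare (hst : Stationary b g Q) (hg : ClassG g) (hb : b < 0)
    (hae : ∀ᵐ x ∂Q, g x ≠ ⊤) (hgQ : (∫⁻ x, (g x).toENNReal ∂Q) ≠ ∞)
    (hB : (∫⁻ x, (g x).toENNReal ^ b) ≠ ∞) (hk : ClassG k) :
    (∫⁻ x, (k x).toENNReal * (g x).toENNReal ^ (b - 1)) + (∫⁻ x, (g x).toENNReal ∂Q) ≤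
      (∫⁻ x, (k x).toENNReal ∂Q) + ∫⁻ x, (g x).toENNReal ^ b := by
  -- If k is Q-integrable, so are all its infimal convolutions, which lie below k.
  by_cases hkQ : (∫⁻ x, (k x).toENNReal ∂Q) = ∞
  · rw [hkQ, top_add]; exact le_top
  obtain ⟨y, hy⟩ := hk.interior_dom
  have hy : y ∈ {x | k x < ⊤} := interior_subset hy
  have hy : (k y).toENNReal ≠ ∞ := EReal.toENNReal_ne_top_iff.2 (ne_of_lt hy)
  set K : EuclideanSpace ℝ (Fin d) → ℝ≥0∞ := fun x => (k x).toENNReal with hK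
  have hof : ∀ n : ℕ, (fun x => ENNReal.ofReal (infConv K n x).toReal) = infConv K n := fun n =>
    funext fun x => ENNReal.ofReal_toReal (infConv_ne_top (K := K) hy x)
  have hcont : ∀ n : ℕ, Continuous fun x => (infConv K n x).toReal := fun n =>
    continuous_toReal_infConv (K := K) n.cast_nonneg hy
  have hmeas : ∀ n : ℕ, Measurable (infConv K n) := fun n => by
    rw [← hof n]; exact (hcont n).measurable.ennreal_ofReal
  have hwm : Measurable fun x => (g x).toENNReal ^ (b - 1) :=
    hg.measurable_toENNReal.pow_const _
  have hn : ∀ n : ℕ, (∫⁻ x, infConv K n x * (g x).toENNReal ^ (b - 1)) +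
      (∫⁻ x, (g x).toENNReal ∂Q) ≤ (∫⁻ x, K x ∂Q) + ∫⁻ x, (g x).toENNReal ^ b := by
    intro n
    have hle : (∫⁻ x, infConv K n x ∂Q) ≤ ∫⁻ x, K x ∂Q :=
      lintegral_mono fun x => infConv_le K n x
    have h := hst.compare_real hg hb hae hgQ hB
      (convexOn_toReal_infConv (K := K) (fun x z a c ha hc hac => hk.toENNReal_combo_le ha hc hac)
        n.cast_nonneg hy) (hcont n) (fun x => ENNReal.toReal_nonneg)
      (by rw [hof n]; exact ne_top_of_le_ne_top hkQ hle)
    simp only [fun x => congrFun (hof n) x] at h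
    exact h.trans (by gcongr)
  have hsup : (∫⁻ x, K x * (g x).toENNReal ^ (b - 1)) =
      ⨆ n : ℕ, ∫⁻ x, infConv K n x * (g x).toENNReal ^ (b - 1) := by
    have hm : ∀ n : ℕ, Measurable fun x => infConv K n x * (g x).toENNReal ^ (b - 1) := fun n =>
      (hmeas n).mul hwm
    rw [← lintegral_iSup hm]
    · refine lintegral_congr fun x => ?_
      rw [← ENNReal.iSup_mul, iSup_infConv hk.lowerSemicontinuous_toENNReal]
    · intro m n hmn x
      dsimp only
      gcongr
      exact infConv_mono K x (Nat.cast_le.2 hmn)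
  rw [hsup, ENNReal.iSup_add]
  exact iSup_le hn

/-- Integrate Young's inequality with base point g and add `Stationary.compare`; the cross term ∫ k
g^(b-1) drops out. If k does no worse than g, the integrated Young inequality is an equality, hence
so is the pointwise one a.e. -/
theorem Stationary.minimal (hst : Stationary b g Q) (hg : ClassG g) (hb : b < 0)
    (hae : ∀ᵐ x ∂Q, g x ≠ ⊤) (hgQ : (∫⁻ x, (g x).toENNReal ∂Q) ≠ ∞)
    (hB : (∫⁻ x, (g x).toENNReal ^ b) ≠ ∞) (hk : ClassG k) :
    ((∫⁻ x, (g x).toENNReal ∂Q) + ENNReal.ofReal (1 / |b|) * ∫⁻ x, (g x).toENNReal ^ b) ≤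
      (∫⁻ x, (k x).toENNReal ∂Q) + ENNReal.ofReal (1 / |b|) * ∫⁻ x, (k x).toENNReal ^ b ∧
    (((∫⁻ x, (k x).toENNReal ∂Q) + ENNReal.ofReal (1 / |b|) * ∫⁻ x, (k x).toENNReal ^ b) ≤
      (∫⁻ x, (g x).toENNReal ∂Q) + ENNReal.ofReal (1 / |b|) * ∫⁻ x, (g x).toENNReal ^ b →
      k =ᵐ[volume] g) := by
  have hcmp := hst.compare hg hb hae hgQ hB hk
  have hgm := hg.measurable_toENNReal
  have hkm := hk.measurable_toENNReal
  have hne := ae_toENNReal_ne_zero hg hb hB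
  have hwm : Measurable fun x => (k x).toENNReal * (g x).toENNReal ^ (b - 1) :=
    hkm.mul (hgm.pow_const _)
  set c := ENNReal.ofReal (1 / |b|) with hc
  have e1 : (∫⁻ x, (c * (g x).toENNReal ^ b + (g x).toENNReal ^ b)) =
      c * (∫⁻ x, (g x).toENNReal ^ b) + ∫⁻ x, (g x).toENNReal ^ b := by
    rw [lintegral_add_left ((hgm.pow_const b).const_mul _),
      lintegral_const_mul _ (hgm.pow_const b)]
  have e2 : (∫⁻ x, ((g x).toENNReal ^ (b - 1) * (k x).toENNReal + c * (k x).toENNReal ^ b)) =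
      (∫⁻ x, (k x).toENNReal * (g x).toENNReal ^ (b - 1)) + c * ∫⁻ x, (k x).toENNReal ^ b := by
    simp only [mul_comm ((g _).toENNReal ^ (b - 1))]
    rw [lintegral_add_left hwm, lintegral_const_mul _ (hkm.pow_const b)]
  have hyoung : (fun x => c * (g x).toENNReal ^ b + (g x).toENNReal ^ b) ≤ᵐ[volume]
      fun x => (g x).toENNReal ^ (b - 1) * (k x).toENNReal + c * (k x).toENNReal ^ b := by
    filter_upwards [hne] with x hx using young_le hb hx
  have hint := lintegral_mono_ae hyoung
  have hcB : c * (∫⁻ x, (g x).toENNReal ^ b) ≠ ∞ := ENNReal.mul_ne_top ENNReal.ofReal_ne_top hB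
  constructor
  · rw [e1, e2] at hint
    refine (ENNReal.add_le_add_iff_right hB).1 ?_
    calc _ = (∫⁻ x, (g x).toENNReal ∂Q) +
          (c * (∫⁻ x, (g x).toENNReal ^ b) + ∫⁻ x, (g x).toENNReal ^ b) := by rw [add_assoc]
      _ ≤ _ := add_le_add_right hint _
      _ = (∫⁻ x, (k x).toENNReal * (g x).toENNReal ^ (b - 1)) + (∫⁻ x, (g x).toENNReal ∂Q) +
          c * ∫⁻ x, (k x).toENNReal ^ b := by ac_rfl
      _ ≤ _ := add_le_add_left hcmp _
      _ = _ := by ac_rfl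
  · intro hle
    have hback : (∫⁻ x, ((g x).toENNReal ^ (b - 1) * (k x).toENNReal + c * (k x).toENNReal ^ b)) ≤
        ∫⁻ x, (c * (g x).toENNReal ^ b + (g x).toENNReal ^ b) := by
      rw [e1, e2]
      refine (ENNReal.add_le_add_iff_right hgQ).1 ?_
      calc _ = (∫⁻ x, (k x).toENNReal * (g x).toENNReal ^ (b - 1)) +
            (∫⁻ x, (g x).toENNReal ∂Q) + c * ∫⁻ x, (k x).toENNReal ^ b := by ac_rfl
        _ ≤ _ := add_le_add_left hcmp _
        _ = (∫⁻ x, (k x).toENNReal ∂Q) + c * (∫⁻ x, (k x).toENNReal ^ b) +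
            ∫⁻ x, (g x).toENNReal ^ b := by ac_rfl
        _ ≤ _ := add_le_add_left hle _
        _ = _ := by ac_rfl
    have hm : Measurable fun x =>
        (g x).toENNReal ^ (b - 1) * (k x).toENNReal + c * (k x).toENNReal ^ b :=
      ((hgm.pow_const _).mul hkm).add ((hkm.pow_const _).const_mul _)
    have heq := ae_eq_of_ae_le_of_lintegral_le hyoung
      (by rw [e1]; exact ENNReal.add_ne_top.2 ⟨hcB, hB⟩) hm.aemeasurable hback
    filter_upwards [heq, hne] with x hx hx0
    by_contra hkg
    refine (young_lt hb hx0 (y := (k x).toENNReal) fun h => hkg ?_).ne hx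
    rw [← hk.coe_toENNReal x, h, hg.coe_toENNReal x]

end Sufficiency

/-! ### Extended integrals and assembly -/

section Main

variable {d : ℕ} {g : EuclideanSpace ℝ (Fin d) → EReal} {h : EuclideanSpace ℝ (Fin d) → ℝ}
  {Q : Measure (EuclideanSpace ℝ (Fin d))} {s : ℝ}

theorem extIntegral_weighted :
    extIntegral volume (weighted s g h) =
      ((∫⁻ x, ENNReal.ofReal (h x) * (g x).toENNReal ^ (1 + 1 / s - 1) : ℝ≥0∞) : EReal) -
      ((∫⁻ x, ENNReal.ofReal (-h x) * (g x).toENNReal ^ (1 + 1 / s - 1) : ℝ≥0∞) : EReal) := by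
  simp only [extIntegral, weighted, toENNReal_coe_mul, toENNReal_neg_coe_mul, powFn,
    add_sub_cancel_left]

theorem extIntegral_coe :
    extIntegral Q (fun x => (h x : EReal)) =
      ((∫⁻ x, ENNReal.ofReal (h x) ∂Q : ℝ≥0∞) : EReal) -
      ((∫⁻ x, ENNReal.ofReal (-h x) ∂Q : ℝ≥0∞) : EReal) := by
  simp only [extIntegral, ← EReal.coe_neg, EReal.real_coe_toENNReal]

theorem hasExtIntegral_weighted (hg : ClassG g) (hm : Measurable h)
    (hN : (∫⁻ x, ENNReal.ofReal (-h x) * (g x).toENNReal ^ (1 + 1 / s - 1)) ≠ ∞) :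
    HasExtIntegral volume (weighted s g h) := by
  refine ⟨(hm.coe_real_ereal.mul
    (hg.measurable_toENNReal.pow_const _).coe_ereal_ennreal).aemeasurable,
    Or.inr ?_⟩
  simpa only [weighted, toENNReal_neg_coe_mul, powFn, add_sub_cancel_left] using hN

/-- The two finiteness premises inside `Stationary` make both extended integrals exist and allow the
differences to be rearranged into sums. -/
theorem stationary_of_forall (hg : ClassG g)
    (H : ∀ h : EuclideanSpace ℝ (Fin d) → ℝ, AdmissibleDirection g h →
      HasExtIntegral volume (weighted s g h) → HasExtIntegral Q (fun x => (h x : EReal)) →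
      extIntegral volume (weighted s g h) ≤ extIntegral Q (fun x => (h x : EReal))) :
    Stationary (1 + 1 / s) g Q := by
  intro h hm hadm hN1 hP2
  have := H h hadm (hasExtIntegral_weighted hg hm hN1)
    ⟨hm.coe_real_ereal.aemeasurable, Or.inl (by simpa only [EReal.real_coe_toENNReal] using hP2)⟩
  rwa [extIntegral_weighted, extIntegral_coe, sub_le_sub_iff_add_le_add hN1 hP2] at this

/-- In the necessity direction it is both negative parts that are finite, while p₂ may be infinite.
-/
theorem extIntegral_le_of_add_le {p₁ n₁ p₂ n₂ : ℝ≥0∞} (h₁ : n₁ ≠ ∞) (h₂ : n₂ ≠ ∞)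
    (h : p₁ + n₂ ≤ p₂ + n₁) : (p₁ : EReal) - (n₁ : EReal) ≤ (p₂ : EReal) - (n₂ : EReal) := by
  rcases eq_or_ne p₂ ∞ with rfl | hp
  · lift n₂ to NNReal using h₂
    have : ((∞ : ℝ≥0∞) : EReal) - ((n₂ : ℝ≥0∞) : EReal) = ⊤ := EReal.top_sub_coe (n₂ : ℝ)
    rw [this]; exact le_top
  · exact (sub_le_sub_iff_add_le_add h₁ hp).2 h

/-- A minimizer satisfies the variational inequality, and all the integrals exist. -/
theorem hasExtIntegral_and_le_of_minimal (hg : ClassG g) (hb : 1 + 1 / s < 0)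
    (hQ : (∫⁻ x, (g x).toENNReal ∂Q) ≠ ∞) (hB : (∫⁻ x, (g x).toENNReal ^ (1 + 1 / s)) ≠ ∞)
    (hle : ∀ k, ClassG k → L s g Q ≤ L s k Q) (hh : AdmissibleDirection g h) :
    HasExtIntegral volume (weighted s g h) ∧ HasExtIntegral Q (fun x => (h x : EReal)) ∧
      extIntegral volume (weighted s g h) ≤ extIntegral Q (fun x => (h x : EReal)) := by
  -- An admissible h is arbitrary on {g = ∞}, possibly non-measurable. That set has zero weight
  -- g^(1/s) and is Q-null, so changing h there is harmless.
  obtain ⟨h', hm, hh'⟩ := exists_measurable_direction hg hh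
  have hadm : AdmissibleDirection g h' := by
    obtain ⟨t₀, ht₀, H⟩ := hh
    exact ⟨t₀, ht₀, fun t ht ht1 => by rw [perturb_congr hh']; exact H t ht ht1⟩
  have hw : weighted s g h = weighted s g h' := by
    ext x
    by_cases hx : g x = ⊤
    · have : (1 : ℝ) / s < 0 := by linarith
      simp only [weighted, powFn, hx, EReal.toENNReal_top, ENNReal.top_rpow_of_neg this,
        EReal.coe_ennreal_zero, mul_zero]
    · rw [weighted, weighted, hh' x hx]
  have hae : ∀ᵐ x ∂Q, h' x = h x := by
    filter_upwards [ae_lt_top hg.measurable_toENNReal hQ] with x hx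
    exact hh' x (EReal.toENNReal_ne_top_iff.1 hx.ne)
  have hN1 := lintegral_ofReal_neg_mul_lt_top hg hadm hb hB
  have hN2 := lintegral_ofReal_neg_lt_top hg hadm hQ
  have hnec := necessity hg hm hadm hb hQ hB hle
  have eP : (∫⁻ x, ENNReal.ofReal (h x) ∂Q) = ∫⁻ x, ENNReal.ofReal (h' x) ∂Q :=
    lintegral_congr_ae (by filter_upwards [hae] with x hx; rw [hx])
  have eN : (∫⁻ x, ENNReal.ofReal (-h x) ∂Q) = ∫⁻ x, ENNReal.ofReal (-h' x) ∂Q :=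
    lintegral_congr_ae (by filter_upwards [hae] with x hx; rw [hx])
  rw [hw]
  refine ⟨hasExtIntegral_weighted hg hm hN1, ⟨⟨fun x => (h' x : EReal), hm.coe_real_ereal, ?_⟩,
    Or.inr ?_⟩, ?_⟩
  · filter_upwards [hae] with x hx; rw [hx]
  · simpa only [← EReal.coe_neg, EReal.real_coe_toENNReal, eN] using hN2
  · rw [extIntegral_weighted, extIntegral_coe, eP, eN]
    exact extIntegral_le_of_add_le hN1 hN2 hnec

theorem finite_of_minimal [IsProbabilityMeasure Q] (hQ : (∫⁻ x, ‖x‖ₑ ∂Q) < ∞)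
    (hbd : 1 + 1 / s < -d) (hb : 1 + 1 / s < 0) (hle : ∀ k, ClassG k → L s g Q ≤ L s k Q) :
    (∫⁻ x, (g x).toENNReal ∂Q) ≠ ∞ ∧ (∫⁻ x, (g x).toENNReal ^ (1 + 1 / s)) ≠ ∞ := by
  have h := hle _ classG_one_add_norm
  have hfin : L s (fun x : EuclideanSpace ℝ (Fin d) =>
      ((ENNReal.ofReal (1 + ‖x‖) : ℝ≥0∞) : EReal)) Q ≠ ∞ := by
    simp only [L, powFn, EReal.toENNReal_coe]
    exact ENNReal.add_ne_top.2 ⟨lintegral_one_add_norm_ne_top hQ,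
      ENNReal.mul_ne_top ENNReal.ofReal_ne_top (lintegral_one_add_norm_rpow_ne_top hbd)⟩
  obtain ⟨h1, h2⟩ := ENNReal.add_ne_top.1 (ne_top_of_le_ne_top hfin h)
  refine ⟨h1, fun h3 => h2 ?_⟩
  have hc : ENNReal.ofReal (1 / |1 + 1 / s|) ≠ 0 := by
    have : 0 < |1 + 1 / s| := abs_pos.2 hb.ne
    simpa only [ne_eq, ENNReal.ofReal_eq_zero, not_le] using one_div_pos.2 this
  simp only [powFn]
  rw [h3, ENNReal.mul_top hc]

end Main

end Renyi

theorem mainTheorem6 (d : ℕ) (hd : 1 ≤ d) (s : ℝ) (hs : -1 / ((d : ℝ) + 1) < s) (hs0 : s < 0)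
    (Q : Measure (EuclideanSpace ℝ (Fin d))) (hQ : Q ∈ Renyi.ClassQ₀ d ∩ Renyi.ClassQ₁ d)
    (g : EuclideanSpace ℝ (Fin d) → EReal) (hg : Renyi.ClassG g) :
    (Renyi.IsRenyiProjection s Q g ↔
      ∀ h : EuclideanSpace ℝ (Fin d) → ℝ, Renyi.AdmissibleDirection g h →
        Renyi.HasExtIntegral volume (Renyi.weighted s g h) →
        Renyi.HasExtIntegral Q (fun x => (h x : EReal)) →
        Renyi.extIntegral volume (Renyi.weighted s g h) ≤
          Renyi.extIntegral Q (fun x => (h x : EReal))) ∧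
    (Renyi.IsRenyiProjection s Q g →
      ∀ h : EuclideanSpace ℝ (Fin d) → ℝ, Renyi.AdmissibleDirection g h →
        Renyi.HasExtIntegral volume (Renyi.weighted s g h) ∧
        Renyi.HasExtIntegral Q (fun x => (h x : EReal))) := by
  obtain ⟨-, hQ1, hQm⟩ := hQ
  -- This is the integrability threshold for (1 + ‖x‖)^β on ℝ^d.
  have hbd : 1 + 1 / s < -d := by
    rw [div_lt_iff₀ (by positivity)] at hs
    have : 1 / s < -((d : ℝ) + 1) := by
      rw [div_lt_iff_of_neg hs0]
      linarith
    linarith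
  have hb : 1 + 1 / s < 0 := hbd.trans_le (by simp)
  have hnec : Renyi.IsRenyiProjection s Q g → ∀ h : EuclideanSpace ℝ (Fin d) → ℝ,
      Renyi.AdmissibleDirection g h → Renyi.HasExtIntegral volume (Renyi.weighted s g h) ∧
        Renyi.HasExtIntegral Q (fun x => (h x : EReal)) ∧
        Renyi.extIntegral volume (Renyi.weighted s g h) ≤
          Renyi.extIntegral Q (fun x => (h x : EReal)) := fun hproj h hh =>
    have hfin := Renyi.finite_of_minimal hQm hbd hb hproj.le
    Renyi.hasExtIntegral_and_le_of_minimal hg hb hfin.1 hfin.2 hproj.le hh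
  refine ⟨⟨fun hproj h hh _ _ => (hnec hproj h hh).2.2, fun H => ?_⟩,
    fun hproj h hh => ⟨(hnec hproj h hh).1, (hnec hproj h hh).2.1⟩⟩
  have hst := Renyi.stationary_of_forall hg H
  obtain ⟨hae, hgQ, hB⟩ := hst.finite hg hbd hb hQm
  refine ⟨hg, fun k hk => (hst.minimal hg hb hae hgQ hB hk).1, fun k hk hkmin => ?_⟩
  have heq := (hst.minimal hg hb hae hgQ hB hk).2 (hkmin g hg)
  exact funext fun x => le_antisymm (hk.le_of_ae_eq hg heq x) (hg.le_of_ae_eq hk heq.symm x)
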